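/- Let $K$ be a field of characteristic zero, let $\mathbb I_1 = K\langle x, \partial, \int\rangle \subseteq \mathrm{End}_K(K[x])$ be the algebra of polynomial integro-differential operators (where $x$ acts by multiplication, $\partial = d/dx$ and $\int x^m = x^{m+1}/(m+1)$), let $A_1 = K\langle x, \partial\rangle \subseteq \mathbb I_1$ be the first Weyl algebra, and let $F = \sum_{i,j\ge 0} K e_{ij} \subseteq \mathbb I_1$, where $e_{ij} = \int^i\partial^j - \int^{i+1}\partial^{j+1}$. Let $A_2 = K\langle x_1, x_2, \partial_1, \partial_2\rangle$ be the second Weyl algebra. The $A_1$-bimodule $\mathbb I_1$ is a left $A_2$-module by means of the isomorphism $A_1 \simeq A_1^{op}$, $x \mapsto \partial$, $\partial\mapsto x$; that is, $x_1 u = xu$, $\partial_1 u = \partial u$, $x_2 u = u\partial$, $\partial_2 u = ux$ for $u \in \mathbb I_1$. The subspaces $A_1$ and $F$ are $A_2$-submodules of $\mathbb I_1$. Let $K[x_1,x_2]$ be the natural $A_2$-module, and let $K[x_1,\partial_2] \simeq A_2/(A_2\partial_1 + A_2x_2)$ be the $A_2$-module on which $x_1$ and $\partial_2$ act by multiplication,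 $\partial_1$ acts as $\partial/\partial x_1$, and $x_2$ acts as minus the derivative with respect to the variable $\partial_2$. A finitely generated $A_2$-module is holonomic if it has Gelfand-Kirillov dimension $2$; its multiplicity is taken with respect to the filtration of Bernstein of $A_2$ (by total degree in $x_1, x_2, \partial_1, \partial_2$). Then: 1. The $A_2$-module $\mathbb I_1$ is holonomic of length $3$. Its composition factors are $F \simeq K[x_1,x_2]$, $A_1$ and $\mathbb I_1/(A_1+F)\simeq K[x_1,\partial_2]$, each occurring once. These three modules are pairwise non-isomorphic, and each of them is a simple holonomic $A_2$-module of multiplicity $1$ whose $A_2$-module endomorphism algebra is $K$. 2. The socle of the $A_2$-module $\mathbb I_1$ (the sum of its simple submodules) is $A_1 \oplus F$; in particular the sum $A_1 + F$ is direct. 3. The short exact sequence of $A_2$-modules $0 \to A_1\oplus F \to \mathbb I_1 \to \mathbb I_1/(A_1+F) \to 0$ does not split. -/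

import Mathlib

noncomputable section

namespace IntDiff

/-! ## The Weyl algebra -/

/-- The defining relations of the `n`-th Weyl algebra. `Sum.inl i` stands for `x_i` and
`Sum.inr i` for `∂_i`. -/
inductive WeylRel (K : Type*) [Field K] (n : ℕ) :
    FreeAlgebra K (Fin n ⊕ Fin n) → FreeAlgebra K (Fin n ⊕ Fin n) → Prop
  | x_comm (i j : Fin n) : WeylRel K n
      (FreeAlgebra.ι K (Sum.inl i) * FreeAlgebra.ι K (Sum.inl j))
      (FreeAlgebra.ι K (Sum.inl j) * FreeAlgebra.ι K (Sum.inl i))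
  | d_comm (i j : Fin n) : WeylRel K n
      (FreeAlgebra.ι K (Sum.inr i) * FreeAlgebra.ι K (Sum.inr j))
      (FreeAlgebra.ι K (Sum.inr j) * FreeAlgebra.ι K (Sum.inr i))
  | d_x (i j : Fin n) : WeylRel K n
      (FreeAlgebra.ι K (Sum.inr i) * FreeAlgebra.ι K (Sum.inl j))
      (FreeAlgebra.ι K (Sum.inl j) * FreeAlgebra.ι K (Sum.inr i) + if i = j then 1 else 0)

/-- The `n`-th Weyl algebra `A_n = K⟨x_1, …, x_n, ∂_1, …, ∂_n⟩`, subject to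
`[x_i, x_j] = [∂_i, ∂_j] = 0` and `[∂_i, x_j] = δ_ij`. -/
abbrev WeylAlgebra (K : Type*) [Field K] (n : ℕ) : Type _ := RingQuot (WeylRel K n)

namespace WeylAlgebra

variable (K : Type*) [Field K] (n : ℕ)

/-- The generator `x_i` of `A_n`. -/
def X (i : Fin n) : WeylAlgebra K n :=
  RingQuot.mkAlgHom K (WeylRel K n) (FreeAlgebra.ι K (Sum.inl i))

/-- The generator `∂_i` of `A_n`. -/
def D (i : Fin n) : WeylAlgebra K n :=
  RingQuot.mkAlgHom K (WeylRel K n) (FreeAlgebra.ι K (Sum.inr i))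

variable {K n}

/-- The universal property of `A_n`: elements of a `K`-algebra which satisfy the defining
relations define an algebra homomorphism from `A_n`. -/
def lift {B : Type*} [Ring B] [Algebra K B] (q p : Fin n → B)
    (hq : ∀ i j, q i * q j = q j * q i) (hp : ∀ i j, p i * p j = p j * p i)
    (hpq : ∀ i j, p i * q j = q j * p i + if i = j then 1 else 0) :
    WeylAlgebra K n →ₐ[K] B :=
  RingQuot.liftAlgHom K ⟨FreeAlgebra.lift K (Sum.elim q p), by
    rintro _ _ (⟨i, j⟩ | ⟨i, j⟩ | ⟨i, j⟩)
    · simpa using hq i j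
    · simpa using hp i j
    · have h := hpq i j
      split_ifs at h ⊢ <;> simpa using h⟩

theorem lift_X {B : Type*} [Ring B] [Algebra K B] (q p : Fin n → B) (hq hp hpq) (i : Fin n) :
    lift (K := K) q p hq hp hpq (X K n i) = q i := by
  simp [lift, X]

theorem lift_D {B : Type*} [Ring B] [Algebra K B] (q p : Fin n → B) (hq hp hpq) (i : Fin n) :
    lift (K := K) q p hq hp hpq (D K n i) = p i := by
  simp [lift, D]

variable (K n) in
/-- The `m`-th term `A_{n, ≤ m}` of the filtration of Bernstein: the span of the monomials
`x_1^{α_1} ⋯ x_n^{α_n} ∂_1^{β_1} ⋯ ∂_n^{β_n}` with `∑ α_i + ∑ β_i ≤ m`. -/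
def bernstein (m : ℕ) : Submodule K (WeylAlgebra K n) :=
  Submodule.span K {a | ∃ α β : Fin n → ℕ, ∑ i, α i + ∑ i, β i ≤ m ∧
    a = (List.ofFn fun i => X K n i ^ α i).prod * (List.ofFn fun i => D K n i ^ β i).prod}

/-- An element of a `K`-subspace closed under all `x_i` and `∂_i` stays there under `A_n`. -/
theorem smul_mem_of_generators {M : Type*} [AddCommGroup M] [Module K M]
    [Module (WeylAlgebra K n) M] [IsScalarTower K (WeylAlgebra K n) M] (N : Submodule K M)
    (hX : ∀ i, ∀ m ∈ N, X K n i • m ∈ N) (hD : ∀ i, ∀ m ∈ N, D K n i • m ∈ N)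
    (a : WeylAlgebra K n) {m : M} (hm : m ∈ N) : a • m ∈ N := by
  obtain ⟨b, rfl⟩ := RingQuot.mkAlgHom_surjective K (WeylRel K n) a
  induction b using FreeAlgebra.induction generalizing m with
  | grade0 r =>
    rw [AlgHom.commutes, algebraMap_smul]
    exact N.smul_mem r hm
  | grade1 v =>
    rcases v with i | i
    · exact hX i m hm
    · exact hD i m hm
  | mul a b iha ihb =>
    rw [map_mul, mul_smul]
    exact iha (ihb hm)
  | add a b iha ihb =>
    rw [map_add, add_smul]
    exact N.add_mem (iha hm) (ihb hm)

/-- A `K`-subspace closed under all `x_i` and `∂_i`, as an `A_n`-submodule. -/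
def submoduleOfGenerators {M : Type*} [AddCommGroup M] [Module K M]
    [Module (WeylAlgebra K n) M] [IsScalarTower K (WeylAlgebra K n) M] (N : Submodule K M)
    (hX : ∀ i, ∀ m ∈ N, X K n i • m ∈ N) (hD : ∀ i, ∀ m ∈ N, D K n i • m ∈ N) :
    Submodule (WeylAlgebra K n) M where
  carrier := N
  add_mem' := N.add_mem
  zero_mem' := N.zero_mem
  smul_mem' a _ hm := smul_mem_of_generators N hX hD a hm

end WeylAlgebra

/-! ## Gelfand-Kirillov dimension, holonomic modules, multiplicity, socle -/

/-- The Gelfand-Kirillov dimension of a module `M` over a `K`-algebra `A`: the supremum, over the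
finite-dimensional subspaces `V ∋ 1` of `A` and `W` of `M`, of
`limsup_i log (dim_K (V ^ i W)) / log i`. -/
def gkDim (K A M : Type*) [Field K] [Ring A] [Algebra K A] [AddCommGroup M] [Module K M]
    [Module A M] [IsScalarTower K A M] : EReal :=
  ⨆ (V : Submodule K A) (_ : (1 : A) ∈ V) (_ : V.FG) (W : Submodule K M) (_ : W.FG),
    Filter.limsup (fun i : ℕ =>
      ((Real.log (Module.finrank K ↥(V ^ i • W)) / Real.log i : ℝ) : EReal)) Filter.atTop

/-- A holonomic `A_n`-module: finitely generated, of Gelfand-Kirillov dimension `n`. -/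
def IsHolonomic (K : Type*) [Field K] (n : ℕ) (M : Type*) [AddCommGroup M] [Module K M]
    [Module (WeylAlgebra K n) M] [IsScalarTower K (WeylAlgebra K n) M] : Prop :=
  Module.Finite (WeylAlgebra K n) M ∧ gkDim K (WeylAlgebra K n) M = (n : EReal)

/-- The holonomic `A_n`-module `M` has multiplicity `e` with respect to the filtration of
Bernstein: `dim_K (A_{n, ≤ i} W) = (e / n!) i ^ n + (lower order terms)` for all
finite-dimensional generating subspaces `W` of `M`. -/
def HasMultiplicity (K : Type*) [Field K] (n : ℕ) (M : Type*) [AddCommGroup M] [Module K M]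
    [Module (WeylAlgebra K n) M] [IsScalarTower K (WeylAlgebra K n) M] (e : ℕ) : Prop :=
  IsHolonomic K n M ∧
  ∀ W : Submodule K M, W.FG → Submodule.span (WeylAlgebra K n) (W : Set M) = ⊤ →
    Filter.Tendsto (fun i : ℕ =>
        (n.factorial : ℝ) * Module.finrank K ↥(WeylAlgebra.bernstein K n i • W) / (i : ℝ) ^ n)
      Filter.atTop (nhds (e : ℝ))

/-- The socle of a module: the sum of its simple submodules. -/
def socle (R M : Type*) [Ring R] [AddCommGroup M] [Module R M] : Submodule R M :=
  sSup {N : Submodule R M | IsSimpleModule R N}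

/-- The `i`-th factor `s_{i+1} / s_i` of a composition series of submodules. -/
abbrev compositionFactor {R M : Type*} [Ring R] [AddCommGroup M] [Module R M]
    (s : CompositionSeries (Submodule R M)) (i : Fin s.length) : Type _ :=
  ↥(s i.succ) ⧸ (s i.castSucc).submoduleOf (s i.succ)

/-! ## The algebra of polynomial integro-differential operators in one variable -/

section IntegroDifferential

variable (K : Type*) [Field K]

/-- Multiplication by `x` on `K[x]`. -/
def opX : Module.End K (Polynomial K) := LinearMap.mulLeft K Polynomial.X

/-- The derivative `∂` on `K[x]`. -/
def opD : Module.End K (Polynomial K) := Polynomial.derivative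

/-- The integral `∫` on `K[x]`: `x ^ m ↦ x ^ (m + 1) / (m + 1)`. -/
def opInt : Module.End K (Polynomial K) :=
  Polynomial.lsum fun m => ((m : K) + 1)⁻¹ • Polynomial.monomial (m + 1)

/-- The algebra `𝕀_1 = K⟨x, ∂, ∫⟩`, as a subalgebra of `End_K(K[x])`. -/
def I1Subalgebra : Subalgebra K (Module.End K (Polynomial K)) :=
  Algebra.adjoin K {opX K, opD K, opInt K}

/-- The algebra `𝕀_1 = K⟨x, ∂, ∫⟩` of polynomial integro-differential operators. -/
def I1 : Type _ := ↥(I1Subalgebra K)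

instance : Ring (I1 K) := inferInstanceAs (Ring ↥(I1Subalgebra K))

instance : Algebra K (I1 K) := inferInstanceAs (Algebra K ↥(I1Subalgebra K))

/-- The inclusion `𝕀_1 ⊆ End_K(K[x])`. -/
def I1.toEnd : I1 K →ₐ[K] Module.End K (Polynomial K) := (I1Subalgebra K).val

theorem I1.toEnd_injective : Function.Injective (I1.toEnd K) := Subtype.val_injective

/-- The element `x` of `𝕀_1`. -/
def I1.x : I1 K := ⟨opX K, Algebra.subset_adjoin (by simp)⟩

/-- The element `∂` of `𝕀_1`. -/
def I1.d : I1 K := ⟨opD K, Algebra.subset_adjoin (by simp)⟩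

/-- The element `∫` of `𝕀_1`. -/
def I1.int : I1 K := ⟨opInt K, Algebra.subset_adjoin (by simp)⟩

theorem I1.toEnd_x : I1.toEnd K (I1.x K) = opX K := rfl

theorem I1.toEnd_d : I1.toEnd K (I1.d K) = opD K := rfl

theorem I1.toEnd_int : I1.toEnd K (I1.int K) = opInt K := rfl

/-- The element `e_{ij} = ∫^i ∂^j - ∫^{i+1} ∂^{j+1}` of `𝕀_1`. -/
def I1.e (i j : ℕ) : I1 K :=
  I1.int K ^ i * I1.d K ^ j - I1.int K ^ (i + 1) * I1.d K ^ (j + 1)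

/-- The first Weyl algebra `A_1 = K⟨x, ∂⟩`, as a subalgebra of `𝕀_1`. -/
def A1 : Subalgebra K (I1 K) := Algebra.adjoin K {I1.x K, I1.d K}

theorem A1.x_mem : I1.x K ∈ A1 K := Algebra.subset_adjoin (by simp)

theorem A1.d_mem : I1.d K ∈ A1 K := Algebra.subset_adjoin (by simp)

theorem I1.d_mul_x : I1.d K * I1.x K = I1.x K * I1.d K + 1 := by
  apply I1.toEnd_injective
  simp only [map_mul, map_add, map_one, I1.toEnd_x, I1.toEnd_d]
  apply LinearMap.ext
  intro p
  simp [opD, opX, add_comm]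

/-- The action of `A_2` on the `A_1`-bimodule `𝕀_1`. An `A_1`-bimodule is a left module over
`A_1 ⊗ A_1ᵒᵖ`, and so over `A_2 = A_1 ⊗ A_1` by means of the isomorphism `A_1 ≃ A_1ᵒᵖ`,
`x ↦ ∂`, `∂ ↦ x`: the generators `x_1`, `∂_1`, `x_2`, `∂_2` of `A_2` act on `u` as
`x u`, `∂ u`, `u ∂`, `u x`. -/
def bimoduleAction : WeylAlgebra K 2 →ₐ[K] Module.End K (I1 K) :=
  WeylAlgebra.lift (B := Module.End K (I1 K))
    ![LinearMap.mulLeft K (I1.x K), LinearMap.mulRight K (I1.d K)]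
    ![LinearMap.mulLeft K (I1.d K), LinearMap.mulRight K (I1.x K)]
    (by
      intro i j
      fin_cases i <;> fin_cases j <;> apply LinearMap.ext <;> intro u <;> simp [mul_assoc])
    (by
      intro i j
      fin_cases i <;> fin_cases j <;> apply LinearMap.ext <;> intro u <;> simp [mul_assoc])
    (by
      have h := I1.d_mul_x K
      intro i j
      fin_cases i <;> fin_cases j <;> apply LinearMap.ext <;> intro u
      · simp [← mul_assoc, h, add_mul]
      · simp [mul_assoc]
      · simp [mul_assoc]
      · simp [mul_assoc, h, mul_add])

instance : Module (WeylAlgebra K 2) (I1 K) :=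
  Module.compHom (I1 K) (bimoduleAction K).toRingHom

theorem I1.smul_def (a : WeylAlgebra K 2) (u : I1 K) : a • u = bimoduleAction K a u := rfl

instance : IsScalarTower K (WeylAlgebra K 2) (I1 K) where
  smul_assoc k a u := by rw [I1.smul_def, I1.smul_def, map_smul, LinearMap.smul_apply]

theorem I1.X_zero_smul (u : I1 K) : WeylAlgebra.X K 2 0 • u = I1.x K * u := by
  rw [I1.smul_def, bimoduleAction, WeylAlgebra.lift_X]; rfl

theorem I1.X_one_smul (u : I1 K) : WeylAlgebra.X K 2 1 • u = u * I1.d K := by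
  rw [I1.smul_def, bimoduleAction, WeylAlgebra.lift_X]; rfl

theorem I1.D_zero_smul (u : I1 K) : WeylAlgebra.D K 2 0 • u = I1.d K * u := by
  rw [I1.smul_def, bimoduleAction, WeylAlgebra.lift_D]; rfl

theorem I1.D_one_smul (u : I1 K) : WeylAlgebra.D K 2 1 • u = u * I1.x K := by
  rw [I1.smul_def, bimoduleAction, WeylAlgebra.lift_D]; rfl

/-- A `K`-subspace of `𝕀_1` closed under left and right multiplication by `x` and `∂`, as an
`A_1`-subbimodule, i.e. an `A_2`-submodule, of `𝕀_1`. -/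
def subbimodule (N : Submodule K (I1 K)) (hxl : ∀ u ∈ N, I1.x K * u ∈ N)
    (hxr : ∀ u ∈ N, u * I1.x K ∈ N) (hdl : ∀ u ∈ N, I1.d K * u ∈ N)
    (hdr : ∀ u ∈ N, u * I1.d K ∈ N) : Submodule (WeylAlgebra K 2) (I1 K) :=
  WeylAlgebra.submoduleOfGenerators N
    (by
      rw [Fin.forall_fin_two]
      simp only [I1.X_zero_smul, I1.X_one_smul]
      exact ⟨hxl, hdr⟩)
    (by
      rw [Fin.forall_fin_two]
      simp only [I1.D_zero_smul, I1.D_one_smul]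
      exact ⟨hdl, hxr⟩)

/-- The subalgebra `A_1`, as an `A_2`-submodule of `𝕀_1`. -/
def A1Sub : Submodule (WeylAlgebra K 2) (I1 K) :=
  subbimodule K (Subalgebra.toSubmodule (A1 K))
    (fun _ hu => (A1 K).mul_mem (A1.x_mem K) hu) (fun _ hu => (A1 K).mul_mem hu (A1.x_mem K))
    (fun _ hu => (A1 K).mul_mem (A1.d_mem K) hu) (fun _ hu => (A1 K).mul_mem hu (A1.d_mem K))

theorem mem_A1Sub {u : I1 K} : u ∈ A1Sub K ↔ u ∈ A1 K := Iff.rfl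

/-- The subspace `F = ⊕ K e_{ij}` of `𝕀_1`. -/
def F : Submodule K (I1 K) := Submodule.span K (Set.range fun p : ℕ × ℕ => I1.e K p.1 p.2)

theorem F.e_mem (i j : ℕ) : I1.e K i j ∈ F K := Submodule.subset_span ⟨(i, j), rfl⟩

theorem F.map_mem (φ : I1 K →ₗ[K] I1 K) (h : ∀ i j, φ (I1.e K i j) ∈ F K) :
    ∀ u ∈ F K, φ u ∈ F K := by
  change F K ≤ (F K).comap φ
  refine Submodule.span_le.mpr ?_
  rintro _ ⟨⟨i, j⟩, rfl⟩
  exact h i j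

theorem opInt_monomial (m : ℕ) (a : K) :
    opInt K (Polynomial.monomial m a) = Polynomial.monomial (m + 1) (((m : K) + 1)⁻¹ * a) := by
  simp [opInt, Polynomial.lsum, Polynomial.smul_monomial]

theorem opD_monomial (m : ℕ) (a : K) :
    opD K (Polynomial.monomial m a) = Polynomial.monomial (m - 1) (a * m) := by
  simp [opD, Polynomial.derivative_monomial]

theorem opX_monomial (m : ℕ) (a : K) :
    opX K (Polynomial.monomial m a) = Polynomial.monomial (m + 1) a := by
  simp [opX, Polynomial.X_mul_monomial]

theorem I1.e_mul_d (i j : ℕ) : I1.e K i j * I1.d K = I1.e K i (j + 1) := by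
  simp only [I1.e, sub_mul, mul_assoc, ← pow_succ]

theorem I1.int_mul_e (i j : ℕ) : I1.int K * I1.e K i j = I1.e K (i + 1) j := by
  simp only [I1.e, mul_sub, ← mul_assoc, ← pow_succ']

end IntegroDifferential

section CharZero

variable (K : Type*) [Field K] [CharZero K]

theorem I1.d_mul_int : I1.d K * I1.int K = 1 := by
  apply I1.toEnd_injective
  refine Polynomial.lhom_ext' fun m => LinearMap.ext fun a => ?_
  have h : (m : K) + 1 ≠ 0 := by exact_mod_cast Nat.succ_ne_zero m
  simp only [map_mul, map_one, I1.toEnd_d, I1.toEnd_int, LinearMap.comp_apply,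
    Module.End.mul_apply, Module.End.one_apply, opInt_monomial, opD_monomial]
  congr 1
  push_cast
  field_simp

theorem I1.int_mul_d_mul_x : I1.int K * (I1.d K * I1.x K) = I1.x K := by
  apply I1.toEnd_injective
  refine Polynomial.lhom_ext' fun m => LinearMap.ext fun a => ?_
  have h : (m : K) + 1 ≠ 0 := by exact_mod_cast Nat.succ_ne_zero m
  simp only [map_mul, I1.toEnd_d, I1.toEnd_int, I1.toEnd_x, LinearMap.comp_apply,
    Module.End.mul_apply, opInt_monomial, opD_monomial, opX_monomial]
  congr 1
  simp only [Nat.add_sub_cancel]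
  push_cast
  field_simp

theorem I1.d_mul_e_zero (j : ℕ) : I1.d K * I1.e K 0 j = 0 := by
  simp only [I1.e, mul_sub, pow_zero, one_mul, zero_add, pow_one]
  rw [← mul_assoc, I1.d_mul_int, one_mul, pow_succ', sub_self]

theorem I1.d_mul_e_succ (i j : ℕ) : I1.d K * I1.e K (i + 1) j = I1.e K i j := by
  simp only [I1.e, mul_sub, pow_succ' (I1.int K), ← mul_assoc, I1.d_mul_int, one_mul]

/-- `x e_{ij} = (i + 1) e_{i+1,j}`. -/
theorem I1.x_mul_e (i j : ℕ) : I1.x K * I1.e K i j = ((i : K) + 1) • I1.e K (i + 1) j := by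
  induction i with
  | zero =>
    nth_rewrite 1 [← I1.int_mul_d_mul_x K]
    rw [I1.d_mul_x, mul_assoc, add_mul, mul_assoc, I1.d_mul_e_zero, mul_zero, zero_add, one_mul,
      I1.int_mul_e]
    simp
  | succ i ih =>
    nth_rewrite 1 [← I1.int_mul_d_mul_x K]
    rw [I1.d_mul_x, mul_assoc, add_mul, mul_assoc, I1.d_mul_e_succ, ih, one_mul, mul_add,
      mul_smul_comm, I1.int_mul_e]
    push_cast
    module

/-- `e_{i,j+1} x = (j + 1) e_{ij}` and `e_{i,0} x = 0`. -/
theorem I1.e_mul_x (i j : ℕ) : I1.e K i j * I1.x K = (j : K) • I1.e K i (j - 1) := by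
  induction j with
  | zero =>
    have h : I1.int K ^ (i + 1) * I1.d K * I1.x K = I1.int K ^ i * I1.x K := by
      rw [pow_succ, mul_assoc, mul_assoc, I1.int_mul_d_mul_x]
    simp [I1.e, sub_mul, h]
  | succ j ih =>
    rw [← I1.e_mul_d, mul_assoc, I1.d_mul_x, mul_add, mul_one, ← mul_assoc, ih, smul_mul_assoc,
      I1.e_mul_d]
    rcases j with _ | j
    · simp
    · simp only [Nat.add_sub_cancel]
      push_cast
      module

/-- `F`, as an `A_2`-submodule of `𝕀_1`. -/
def FSub : Submodule (WeylAlgebra K 2) (I1 K) :=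
  subbimodule K (F K)
    (F.map_mem K (LinearMap.mulLeft K (I1.x K)) fun i j => by
      rw [LinearMap.mulLeft_apply, I1.x_mul_e]
      exact (F K).smul_mem _ (F.e_mem K _ _))
    (F.map_mem K (LinearMap.mulRight K (I1.x K)) fun i j => by
      rw [LinearMap.mulRight_apply, I1.e_mul_x]
      exact (F K).smul_mem _ (F.e_mem K _ _))
    (F.map_mem K (LinearMap.mulLeft K (I1.d K)) fun i j => by
      rw [LinearMap.mulLeft_apply]
      rcases i with _ | i
      · rw [I1.d_mul_e_zero]
        exact (F K).zero_mem
      · rw [I1.d_mul_e_succ]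
        exact F.e_mem K _ _)
    (F.map_mem K (LinearMap.mulRight K (I1.d K)) fun i j => by
      rw [LinearMap.mulRight_apply, I1.e_mul_d]
      exact F.e_mem K _ _)

theorem mem_FSub {u : I1 K} : u ∈ FSub K ↔ u ∈ F K := Iff.rfl

end CharZero

/-! ## The `A_2`-modules `K[x_1, x_2]` and `K[x_1, ∂_2]` -/

section PolynomialModules

variable (K : Type*) [Field K]

/-- Multiplication by the `i`-th variable on the polynomial algebra in two variables. -/
def mulVar (i : Fin 2) : Module.End K (MvPolynomial (Fin 2) K) :=
  LinearMap.mulLeft K (MvPolynomial.X i)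

/-- The partial derivative by the `i`-th variable on the polynomial algebra in two variables. -/
def partialD (i : Fin 2) : Module.End K (MvPolynomial (Fin 2) K) :=
  (MvPolynomial.pderiv i).toLinearMap

theorem mulVar_comm (i j : Fin 2) : mulVar K i * mulVar K j = mulVar K j * mulVar K i := by
  apply LinearMap.ext
  intro p
  simp [mulVar, mul_left_comm]

theorem partialD_comm (i j : Fin 2) :
    partialD K i * partialD K j = partialD K j * partialD K i := by
  apply LinearMap.ext
  intro p
  have h : ⁅MvPolynomial.pderiv (R := K) i, MvPolynomial.pderiv (R := K) j⁆ =
      (0 : Derivation K (MvPolynomial (Fin 2) K) (MvPolynomial (Fin 2) K)) := by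
    classical
    apply MvPolynomial.derivation_ext
    intro k
    simp only [Derivation.commutator_apply, MvPolynomial.pderiv_X, Pi.single_apply]
    split_ifs <;> simp
  have h2 := DFunLike.congr_fun h p
  simpa [partialD, Derivation.commutator_apply, sub_eq_zero] using h2

theorem partialD_mulVar (i j : Fin 2) :
    partialD K i * mulVar K j = mulVar K j * partialD K i + if i = j then 1 else 0 := by
  apply LinearMap.ext
  intro p
  split_ifs with h
  · subst h
    simp [partialD, mulVar]
  · simp [partialD, mulVar, MvPolynomial.pderiv_X_of_ne (Ne.symm h)]

/-- The `A_2`-module `K[x_1, x_2]`: `x_i` acts by multiplication, `∂_i` by differentiation. -/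
def PolyXX : Type _ := MvPolynomial (Fin 2) K

/-- The `A_2`-module `K[x_1, ∂_2]`, isomorphic to `A_2 / (A_2 ∂_1 + A_2 x_2)`. The variables with
indices `0` and `1` of the polynomial algebra are `x_1` and `∂_2`: the elements `x_1` and `∂_2` of
`A_2` act by multiplication, `∂_1` acts as `∂/∂x_1`, and `x_2` as the negative of the derivative
by the variable `∂_2`. -/
def PolyXD : Type _ := MvPolynomial (Fin 2) K

instance : AddCommGroup (PolyXX K) := inferInstanceAs (AddCommGroup (MvPolynomial (Fin 2) K))

instance : Module K (PolyXX K) := inferInstanceAs (Module K (MvPolynomial (Fin 2) K))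

instance : AddCommGroup (PolyXD K) := inferInstanceAs (AddCommGroup (MvPolynomial (Fin 2) K))

instance : Module K (PolyXD K) := inferInstanceAs (Module K (MvPolynomial (Fin 2) K))

/-- The action of `A_2` on `K[x_1, x_2]`. -/
def actionXX : WeylAlgebra K 2 →ₐ[K] Module.End K (PolyXX K) :=
  WeylAlgebra.lift (B := Module.End K (MvPolynomial (Fin 2) K)) (mulVar K) (partialD K)
    (mulVar_comm K) (partialD_comm K) (partialD_mulVar K)

/-- The action of `A_2` on `K[x_1, ∂_2]`. -/
def actionXD : WeylAlgebra K 2 →ₐ[K] Module.End K (PolyXD K) :=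
  WeylAlgebra.lift (B := Module.End K (MvPolynomial (Fin 2) K))
    ![mulVar K 0, -partialD K 1] ![partialD K 0, mulVar K 1]
    (by
      have h : ∀ p, partialD K 1 (mulVar K 0 p) = mulVar K 0 (partialD K 1 p) := fun p => by
        simpa using LinearMap.congr_fun (partialD_mulVar K 1 0) p
      intro i j
      fin_cases i <;> fin_cases j <;> apply LinearMap.ext <;> intro p <;> simp [h])
    (by
      have h : ∀ p, partialD K 0 (mulVar K 1 p) = mulVar K 1 (partialD K 0 p) := fun p => by
        simpa using LinearMap.congr_fun (partialD_mulVar K 0 1) p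
      intro i j
      fin_cases i <;> fin_cases j <;> apply LinearMap.ext <;> intro p <;> simp [h])
    (by
      have h0 : ∀ p, partialD K 0 (mulVar K 0 p) = mulVar K 0 (partialD K 0 p) + p := fun p => by
        simpa using LinearMap.congr_fun (partialD_mulVar K 0 0) p
      have h1 : ∀ p, partialD K 1 (mulVar K 1 p) = mulVar K 1 (partialD K 1 p) + p := fun p => by
        simpa using LinearMap.congr_fun (partialD_mulVar K 1 1) p
      have hx : ∀ p, mulVar K 0 (mulVar K 1 p) = mulVar K 1 (mulVar K 0 p) :=
        LinearMap.congr_fun (mulVar_comm K 0 1)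
      have hd : ∀ p, partialD K 0 (partialD K 1 p) = partialD K 1 (partialD K 0 p) :=
        LinearMap.congr_fun (partialD_comm K 0 1)
      intro i j
      fin_cases i <;> fin_cases j <;> apply LinearMap.ext <;> intro p <;> simp [h0, h1, hx, hd])

instance : Module (WeylAlgebra K 2) (PolyXX K) :=
  Module.compHom (PolyXX K) (actionXX K).toRingHom

instance : IsScalarTower K (WeylAlgebra K 2) (PolyXX K) where
  smul_assoc k a u := by
    change actionXX K (k • a) u = k • actionXX K a u
    rw [map_smul, LinearMap.smul_apply]

instance : Module (WeylAlgebra K 2) (PolyXD K) :=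
  Module.compHom (PolyXD K) (actionXD K).toRingHom

instance : IsScalarTower K (WeylAlgebra K 2) (PolyXD K) where
  smul_assoc k a u := by
    change actionXD K (k • a) u = k • actionXD K a u
    rw [map_smul, LinearMap.smul_apply]

end PolynomialModules

end IntDiff

end

open IntDiff

/-! Each of the three factors has a `K`-basis indexed by `ℕ × ℕ` on which `A_2` acts as on the
monomials of a polynomial ring in two variables, up to a linear change of generators: two operators
raise an exponent, two act as partial derivatives. `IsLadder` records this pattern. For `F` the
basis is `i! e_{ij}` with the usual generators. For `A_1` it is `x^i ∂^j`, raised by `x_1`, `x_2`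
and lowered by the commutators `∂_1 - x_2`, `∂_2 - x_1`. For the quotient it consists of the classes
of `x^i ∫ x^j`, raised by `x_1`, `∂_2` and lowered by `∂_1`, `-x_2`.

Lowering a nonzero element by an exponent of maximal total degree leaves a multiple of the bottom
vector, nonzero in characteristic zero (`IsLadder.exists_lowering`). Linear independence, simplicity
and the scalar endomorphism ring follow. Counting exponents gives dimension `2` and multiplicity
`1`. Ladders for the same operators are isomorphic, which identifies the factors with the polynomial
modules.

The identities `∂∫ = 1`, `∫∂ = 1 - e_{00}` and integration by parts show that the three families
together span `𝕀_1` (`ladderSpan_eq_top`). The quotient is nonzero because `∫` is not in `A_1 + F`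
(`I1.int_notMem`). The factors are told apart by local nilpotence of `∂_1` or `∂_2`, so `A_1` and
`F` are distinct simple submodules, hence disjoint, and Jordan–Hölder applies.

The sequence does not split because the class of `∫` is killed by right multiplication by `∂`, which
is injective on `𝕀_1` (`not_exists_section`). A simple submodule outside `A_1 + F` would be a
complement and so give a section; this determines the socle. -/

noncomputable section

namespace IntDiff

/-! ### Commutation rules in an algebra with `dx = xd + 1`. -/

section RingLemmas

variable {K A : Type*} [Field K] [Ring A] [Algebra K A]

theorem mul_pow_of_mul_eq_add_one {d x : A} (h : d * x = x * d + 1) (n : ℕ) :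
    d * x ^ n = x ^ n * d + (n : K) • x ^ (n - 1) := by
  induction n with
  | zero => simp
  | succ n ih =>
    rw [pow_succ, ← mul_assoc, ih, add_mul, mul_assoc, h, mul_add, mul_one]
    rcases n with _ | n
    · simp
    · simp only [Nat.add_sub_cancel, smul_mul_assoc, ← pow_succ, ← mul_assoc]
      push_cast
      module

theorem pow_mul_of_mul_eq_add_one {d x : A} (h : d * x = x * d + 1) (n : ℕ) :
    d ^ n * x = x * d ^ n + (n : K) • d ^ (n - 1) := by
  induction n with
  | zero => simp
  | succ n ih =>
    rw [pow_succ', mul_assoc, ih, mul_add, ← mul_assoc, h, add_mul, one_mul, mul_assoc]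
    rcases n with _ | n
    · simp
    · simp only [Nat.add_sub_cancel, mul_smul_comm, ← pow_succ']
      push_cast
      module

theorem mul_mem_of_mem_adjoin {s : Set A} {N : Submodule K A} (h : ∀ a ∈ s, ∀ u ∈ N, a * u ∈ N)
    {a : A} (ha : a ∈ Algebra.adjoin K s) {u : A} (hu : u ∈ N) : a * u ∈ N := by
  induction ha using Algebra.adjoin_induction generalizing u with
  | mem a ha => exact h a ha u hu
  | algebraMap r => rw [← Algebra.smul_def]; exact N.smul_mem r hu
  | add a b _ _ iha ihb => rw [add_mul]; exact N.add_mem (iha hu) (ihb hu)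
  | mul a b _ _ iha ihb => rw [mul_assoc]; exact iha (ihb hu)

end RingLemmas

/-! ### Normally ordered monomials and the Bernstein filtration of `A_2`. -/

namespace WeylAlgebra

section Relations

variable (K : Type*) [Field K] (n : ℕ)

theorem X_mul_X (i j : Fin n) : X K n i * X K n j = X K n j * X K n i := by
  simpa [X] using RingQuot.mkAlgHom_rel K (WeylRel.x_comm (K := K) i j)

theorem D_mul_D (i j : Fin n) : D K n i * D K n j = D K n j * D K n i := by
  simpa [D] using RingQuot.mkAlgHom_rel K (WeylRel.d_comm (K := K) i j)

theorem D_mul_X (i j : Fin n) :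
    D K n i * X K n j = X K n j * D K n i + if i = j then 1 else 0 := by
  have h := RingQuot.mkAlgHom_rel K (WeylRel.d_x (K := K) i j)
  split_ifs at h ⊢ <;> simpa [X, D] using h

theorem D_mul_X_self (i : Fin n) : D K n i * X K n i = X K n i * D K n i + 1 := by
  simp [D_mul_X]

theorem D_commute_X {i j : Fin n} (h : i ≠ j) : Commute (D K n i) (X K n j) := by
  simp [Commute, SemiconjBy, D_mul_X, h]

theorem D_mul_X_pow (i : Fin n) (a : ℕ) :
    D K n i * X K n i ^ a = X K n i ^ a * D K n i + (a : K) • X K n i ^ (a - 1) :=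
  mul_pow_of_mul_eq_add_one (D_mul_X_self K n i) a

end Relations

/-- The normally ordered monomial `x_1^a x_2^b ∂_1^c ∂_2^d` of `A_2`. -/
def monomial (K : Type*) [Field K] (a b c d : ℕ) : WeylAlgebra K 2 :=
  X K 2 0 ^ a * X K 2 1 ^ b * (D K 2 0 ^ c * D K 2 1 ^ d)

/-- The span of `1` and the generators of `A_2`. -/
def generatorSpan (K : Type*) [Field K] : Submodule K (WeylAlgebra K 2) :=
  Submodule.span K {1, X K 2 0, X K 2 1, D K 2 0, D K 2 1}

variable (K : Type*) [Field K]

theorem one_mem_generatorSpan : 1 ∈ generatorSpan K := Submodule.subset_span (by simp)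

theorem X_mem_generatorSpan (i : Fin 2) : X K 2 i ∈ generatorSpan K := by
  fin_cases i <;> exact Submodule.subset_span (by simp)

theorem D_mem_generatorSpan (i : Fin 2) : D K 2 i ∈ generatorSpan K := by
  fin_cases i <;> exact Submodule.subset_span (by simp)

theorem generatorSpan_fg : (generatorSpan K).FG := Submodule.fg_span (by simp)

theorem bernstein_two_eq_span (m : ℕ) : bernstein K 2 m =
    Submodule.span K {u | ∃ a b c d : ℕ, a + b + (c + d) ≤ m ∧ u = monomial K a b c d} := by
  rw [bernstein]
  congr 1
  ext u
  constructor
  · rintro ⟨α, β, h, rfl⟩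
    exact ⟨α 0, α 1, β 0, β 1, by simpa using h, by simp [monomial, List.ofFn_succ]⟩
  · rintro ⟨a, b, c, d, h, rfl⟩
    exact ⟨![a, b], ![c, d], by simpa using h, by simp [monomial, List.ofFn_succ]⟩

theorem monomial_mem_bernstein {a b c d m : ℕ} (h : a + b + (c + d) ≤ m) :
    monomial K a b c d ∈ bernstein K 2 m := by
  rw [bernstein_two_eq_span]
  exact Submodule.subset_span ⟨a, b, c, d, h, rfl⟩

theorem X_zero_mul_monomial (a b c d : ℕ) :
    X K 2 0 * monomial K a b c d = monomial K (a + 1) b c d := by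
  simp only [monomial, pow_succ' _ a, mul_assoc]

theorem X_one_mul_monomial (a b c d : ℕ) :
    X K 2 1 * monomial K a b c d = monomial K a (b + 1) c d := by
  have h : X K 2 1 * X K 2 0 ^ a = X K 2 0 ^ a * X K 2 1 :=
    (Commute.pow_right (X_mul_X K 2 1 0 : Commute _ _) a)
  simp only [monomial, pow_succ' _ b, ← mul_assoc, h]

theorem D_zero_mul_monomial (a b c d : ℕ) : D K 2 0 * monomial K a b c d =
    monomial K a b (c + 1) d + (a : K) • monomial K (a - 1) b c d := by
  have h : D K 2 0 * X K 2 1 ^ b = X K 2 1 ^ b * D K 2 0 :=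
    ((D_commute_X K 2 (by simp : (0 : Fin 2) ≠ 1)).pow_right b)
  simp only [monomial, ← mul_assoc, D_mul_X_pow, add_mul, smul_mul_assoc]
  rw [mul_assoc (X K 2 0 ^ a), h]
  simp only [pow_succ' _ c, mul_assoc]

theorem D_one_mul_monomial (a b c d : ℕ) : D K 2 1 * monomial K a b c d =
    monomial K a b c (d + 1) + (b : K) • monomial K a (b - 1) c d := by
  have h : D K 2 1 * X K 2 0 ^ a = X K 2 0 ^ a * D K 2 1 :=
    ((D_commute_X K 2 (by simp : (1 : Fin 2) ≠ 0)).pow_right a)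
  have h' : D K 2 1 * D K 2 0 ^ c = D K 2 0 ^ c * D K 2 1 :=
    Commute.pow_right (D_mul_D K 2 1 0 : Commute _ _) c
  simp only [monomial, ← mul_assoc, h]
  rw [mul_assoc (X K 2 0 ^ a), D_mul_X_pow]
  simp only [mul_add, add_mul, smul_mul_assoc, mul_smul_comm, mul_assoc, pow_succ' _ d]
  rw [← mul_assoc (D K 2 1) (D K 2 0 ^ c), h', mul_assoc]

theorem monomial_mem_generatorSpan_pow (a b c d : ℕ) :
    monomial K a b c d ∈ generatorSpan K ^ (a + b + (c + d)) := by
  rw [pow_add, pow_add, pow_add, monomial]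
  have hX := fun i k => Submodule.pow_mem_pow _ (X_mem_generatorSpan K i) k
  have hD := fun i k => Submodule.pow_mem_pow _ (D_mem_generatorSpan K i) k
  exact Submodule.mul_mem_mul (Submodule.mul_mem_mul (hX _ _) (hX _ _))
    (Submodule.mul_mem_mul (hD _ _) (hD _ _))

theorem generatorSpan_pow_mono : Monotone fun m => generatorSpan K ^ m := fun _ _ h =>
  pow_le_pow_right' (Submodule.one_le.mpr (one_mem_generatorSpan K)) h

/-- Restoring normal order after multiplying by `∂_i` on the left costs only one extra monomial, of
smaller degree. -/
theorem generatorSpan_mul_bernstein_le (m : ℕ) :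
    generatorSpan K * bernstein K 2 m ≤ bernstein K 2 (m + 1) := by
  rw [bernstein_two_eq_span K m, generatorSpan, Submodule.span_mul_span, Submodule.span_le]
  rintro _ ⟨v, hv, _, ⟨a, b, c, d, h, rfl⟩, rfl⟩
  simp only [Set.mem_insert_iff, Set.mem_singleton_iff] at hv
  rcases hv with rfl | rfl | rfl | rfl | rfl
  · simpa using monomial_mem_bernstein K (by omega)
  · simpa [X_zero_mul_monomial] using monomial_mem_bernstein K (by omega)
  · simpa [X_one_mul_monomial] using monomial_mem_bernstein K (by omega)
  · simp only [D_zero_mul_monomial]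
    exact Submodule.add_mem _ (monomial_mem_bernstein K (by omega))
      (Submodule.smul_mem _ _ (monomial_mem_bernstein K (by omega)))
  · simp only [D_one_mul_monomial]
    exact Submodule.add_mem _ (monomial_mem_bernstein K (by omega))
      (Submodule.smul_mem _ _ (monomial_mem_bernstein K (by omega)))

/-- This turns the Bernstein filtration into powers of one subspace, so the multiplicity and the
Gelfand-Kirillov dimension can use the same growth estimates. -/
theorem bernstein_eq_generatorSpan_pow (m : ℕ) : bernstein K 2 m = generatorSpan K ^ m := by
  apply le_antisymm
  · rw [bernstein_two_eq_span, Submodule.span_le]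
    rintro _ ⟨a, b, c, d, h, rfl⟩
    exact generatorSpan_pow_mono K h (monomial_mem_generatorSpan_pow K a b c d)
  · induction m with
    | zero =>
      rw [pow_zero, Submodule.one_le]
      simpa [monomial] using monomial_mem_bernstein K (a := 0) (b := 0) (c := 0) (d := 0) le_rfl
    | succ m ih =>
      rw [pow_succ']
      exact (mul_le_mul' le_rfl ih).trans (generatorSpan_mul_bernstein_le K m)

theorem exists_mem_generatorSpan_pow (a : WeylAlgebra K 2) : ∃ m, a ∈ generatorSpan K ^ m := by
  obtain ⟨b, rfl⟩ := RingQuot.mkAlgHom_surjective K (WeylRel K 2) a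
  induction b using FreeAlgebra.induction with
  | grade0 r =>
    refine ⟨0, ?_⟩
    rw [AlgHom.commutes, pow_zero]
    exact Submodule.algebraMap_mem r
  | grade1 v =>
    refine ⟨1, ?_⟩
    rw [pow_one]
    rcases v with i | i
    · exact X_mem_generatorSpan K i
    · exact D_mem_generatorSpan K i
  | mul a b iha ihb =>
    obtain ⟨m, hm⟩ := iha
    obtain ⟨k, hk⟩ := ihb
    refine ⟨m + k, ?_⟩
    rw [map_mul, pow_add]
    exact Submodule.mul_mem_mul hm hk
  | add a b iha ihb =>
    obtain ⟨m, hm⟩ := iha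
    obtain ⟨k, hk⟩ := ihb
    refine ⟨max m k, ?_⟩
    rw [map_add]
    exact Submodule.add_mem _ (generatorSpan_pow_mono K (le_max_left m k) hm)
      (generatorSpan_pow_mono K (le_max_right m k) hk)

/-- A finitely generated subspace lies in one of the terms of an exhaustive filtration. -/
theorem exists_le_of_fg {M : Type*} [AddCommGroup M] [Module K M] {S : ℕ → Submodule K M}
    (hS : Monotone S) (hex : ∀ u, ∃ m, u ∈ S m) {W : Submodule K M} (hW : W.FG) :
    ∃ m, W ≤ S m := by
  obtain ⟨s, rfl⟩ := hW
  choose f hf using hex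
  refine ⟨s.sup f, Submodule.span_le.mpr fun u hu => ?_⟩
  exact hS (Finset.le_sup (f := f) hu) (hf u)

theorem exists_le_generatorSpan_pow {V : Submodule K (WeylAlgebra K 2)} (hV : V.FG) :
    ∃ m, V ≤ generatorSpan K ^ m :=
  exists_le_of_fg K (generatorSpan_pow_mono K) (exists_mem_generatorSpan_pow K) hV

variable {K} {M : Type*} [AddCommGroup M] [Module K M] [Module (WeylAlgebra K 2) M]
  [IsScalarTower K (WeylAlgebra K 2) M]

theorem generatorSpan_pow_smul_le {S : ℕ → Submodule K M}
    (hS : ∀ i, generatorSpan K • S i ≤ S (i + 1)) (m i : ℕ) :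
    generatorSpan K ^ m • S i ≤ S (i + m) := by
  induction m with
  | zero => rw [pow_zero, Submodule.one_smul, add_zero]
  | succ m ih =>
    rw [pow_succ', ← smul_eq_mul, Submodule.smul_assoc]
    exact (Submodule.smul_mono le_rfl ih).trans (hS _)

theorem exists_mem_generatorSpan_pow_smul {W : Submodule K M} {u : M}
    (hu : u ∈ Submodule.span (WeylAlgebra K 2) (W : Set M)) :
    ∃ m, u ∈ generatorSpan K ^ m • W := by
  induction hu using Submodule.span_induction with
  | mem u hu => exact ⟨0, by rwa [pow_zero, Submodule.one_smul]⟩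
  | zero => exact ⟨0, Submodule.zero_mem _⟩
  | add u v _ _ ihu ihv =>
    obtain ⟨m, hm⟩ := ihu
    obtain ⟨k, hk⟩ := ihv
    exact ⟨max m k, Submodule.add_mem _
      (Submodule.smul_mono_left (generatorSpan_pow_mono K (le_max_left m k)) hm)
      (Submodule.smul_mono_left (generatorSpan_pow_mono K (le_max_right m k)) hk)⟩
  | smul a u _ ihu =>
    obtain ⟨m, hm⟩ := ihu
    obtain ⟨k, hk⟩ := exists_mem_generatorSpan_pow K a
    refine ⟨k + m, ?_⟩
    rw [pow_add, ← smul_eq_mul, Submodule.smul_assoc]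
    exact Submodule.smul_mem_smul hk hm

end WeylAlgebra

/-! ### Quadratic growth and Gelfand-Kirillov dimension two. -/

section Growth

open Filter Topology

/-- The constant contributes `log C / log i`, which tends to zero; only the exponent survives. -/
theorem tendsto_log_mul_sq_div_log {C : ℝ} (hC : 0 < C) :
    Tendsto (fun i : ℕ => ((Real.log (C * (i : ℝ) ^ 2) / Real.log i : ℝ) : EReal)) atTop
      (𝓝 ((2 : ℕ) : EReal)) := by
  have hlog : Tendsto (fun i : ℕ => Real.log (i : ℝ)) atTop atTop :=
    Real.tendsto_log_atTop.comp tendsto_natCast_atTop_atTop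
  have h : Tendsto (fun i : ℕ => Real.log C / Real.log i + 2) atTop (𝓝 (0 + 2)) :=
    (hlog.const_div_atTop _).add_const 2
  rw [zero_add] at h
  have h2 : ((2 : ℕ) : EReal) = ((2 : ℝ) : EReal) := by norm_num; rfl
  rw [h2]
  refine (continuous_coe_real_ereal.tendsto 2).comp (h.congr' ?_)
  filter_upwards [eventually_gt_atTop 1] with i hi
  have hi' : (1 : ℝ) < i := by exact_mod_cast hi
  have hl : Real.log i ≠ 0 := (Real.log_pos hi').ne'
  rw [Real.log_mul hC.ne' (by positivity), Real.log_pow, add_div]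
  push_cast
  rw [mul_div_cancel_right₀ _ hl]

variable {K : Type*} [Field K] {M : Type*} [AddCommGroup M] [Module K M]
  [Module (WeylAlgebra K 2) M] [IsScalarTower K (WeylAlgebra K 2) M]

open WeylAlgebra

/-- A module with an exhaustive filtration of quadratic growth has Gelfand-Kirillov dimension at
most `2`. -/
theorem gkDim_le_two {S : ℕ → Submodule K M} (hS : Monotone S) (hex : ∀ u, ∃ m, u ∈ S m)
    (hV : ∀ i, generatorSpan K • S i ≤ S (i + 1)) (hfg : ∀ i, (S i).FG) (C : ℕ)
    (hC : ∀ i, Module.finrank K (S i) ≤ C * (i + 1) ^ 2) :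
    gkDim K (WeylAlgebra K 2) M ≤ ((2 : ℕ) : EReal) := by
  refine iSup_le fun V => iSup_le fun _ => iSup_le fun hVfg => iSup_le fun W => iSup_le fun hW => ?_
  obtain ⟨d, hd⟩ := exists_le_generatorSpan_pow K hVfg
  obtain ⟨a, ha⟩ := exists_le_of_fg K hS hex hW
  -- With `V ⊆ G^d` for the generator span `G` and `W ⊆ S a`, the space `V^i W` lies in `S (a + d
  -- i)`. Using `C + 1` in place of `C` keeps the constant positive even for `C = 0`.
  have hC' : (0 : ℝ) < (C + 1) * (d + a + 1) ^ 2 := by positivity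
  rw [← (tendsto_log_mul_sq_div_log hC').limsup_eq]
  refine limsup_le_limsup ?_
  filter_upwards [eventually_gt_atTop 1] with i hi
  have hle : V ^ i • W ≤ S (a + d * i) := by
    refine (Submodule.smul_mono (pow_le_pow_left' hd i) ha).trans ?_
    rw [← pow_mul]
    exact generatorSpan_pow_smul_le hV _ _
  have : Module.Finite K (S (a + d * i)) := Module.Finite.iff_fg.mpr (hfg _)
  have hdim := (Submodule.finrank_mono hle).trans (hC _)
  have hi' : (1 : ℝ) < i := by exact_mod_cast hi
  have hbound : (Module.finrank K ↥(V ^ i • W) : ℝ) ≤ (C + 1) * (d + a + 1) ^ 2 * (i : ℝ) ^ 2 := by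
    have h1 : (Module.finrank K ↥(V ^ i • W) : ℝ) ≤ C * (a + d * i + 1) ^ 2 := by
      exact_mod_cast hdim
    have h2 : (a + d * i + 1 : ℝ) ≤ (d + a + 1) * i := by
      nlinarith [(Nat.cast_nonneg a : (0 : ℝ) ≤ a)]
    calc _ ≤ _ := h1
      _ ≤ (C + 1) * ((d + a + 1) * i) ^ 2 := by gcongr; linarith
      _ = _ := by ring
  have hlog := (Real.log_pos hi').le
  rw [EReal.coe_le_coe_iff]
  refine div_le_div_of_nonneg_right ?_ hlog
  -- Monotonicity of the logarithm needs a positive dimension; in dimension zero the convention `log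
  -- 0 = 0` applies.
  rcases Nat.eq_zero_or_pos (Module.finrank K ↥(V ^ i • W)) with h0 | hpos
  · rw [h0, Nat.cast_zero, Real.log_zero]
    refine Real.log_nonneg ?_
    have : (1 : ℝ) ≤ (C + 1) * (d + a + 1) ^ 2 := by
      have : (1 : ℝ) ≤ ((C + 1) * (d + a + 1) ^ 2 : ℕ) := by
        exact_mod_cast Nat.succ_le_of_lt (by positivity)
      exact_mod_cast this
    nlinarith
  · exact Real.log_le_log (by exact_mod_cast hpos) hbound

/-- A module with a finite-dimensional subspace of quadratic growth has Gelfand-Kirillov dimension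
at least `2`. -/
theorem two_le_gkDim {W : Submodule K M} (hW : W.FG)
    (h : ∀ i, (i + 1) * (i + 2) ≤ 2 * Module.finrank K ↥(generatorSpan K ^ i • W)) :
    ((2 : ℕ) : EReal) ≤ gkDim K (WeylAlgebra K 2) M := by
  refine le_trans ?_ (le_iSup_of_le (generatorSpan K) (le_iSup_of_le (one_mem_generatorSpan K)
    (le_iSup_of_le (generatorSpan_fg K) (le_iSup_of_le W (le_iSup_of_le hW le_rfl)))))
  rw [← (tendsto_log_mul_sq_div_log (by norm_num : (0 : ℝ) < 1 / 2)).limsup_eq]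
  refine limsup_le_limsup ?_
  filter_upwards [eventually_gt_atTop 1] with i hi
  have hi' : (1 : ℝ) < i := by exact_mod_cast hi
  have h' : ((i : ℝ) + 1) * (i + 2) ≤ 2 * Module.finrank K ↥(generatorSpan K ^ i • W) := by
    exact_mod_cast h i
  rw [EReal.coe_le_coe_iff]
  refine div_le_div_of_nonneg_right ?_ (Real.log_pos hi').le
  exact Real.log_le_log (by positivity) (by nlinarith)

end Growth

theorem span_smul_span_le {K A M : Type*} [Field K] [Ring A] [Algebra K A] [AddCommGroup M]
    [Module K M] [Module A M] [IsScalarTower K A M] {S : Set A} {T : Set M} {N : Submodule K M}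
    (h : ∀ a ∈ S, ∀ u ∈ T, a • u ∈ N) : Submodule.span K S • Submodule.span K T ≤ N := by
  refine Submodule.smul_le.mpr fun a ha u hu => ?_
  induction ha, hu using Submodule.span_induction₂ with
  | mem_mem a u ha hu => exact h a ha u hu
  | zero_left u _ => simp
  | zero_right a _ => simp
  | add_left a a' u _ _ _ h h' => rw [add_smul]; exact N.add_mem h h'
  | add_right a u u' _ _ _ h h' => rw [smul_add]; exact N.add_mem h h'
  | smul_left c a u _ _ h => rw [smul_assoc]; exact N.smul_mem c h
  | smul_right c a u _ _ h => rw [smul_algebra_smul_comm]; exact N.smul_mem c h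

open Filter in
theorem tendsto_mul_div_sq (r s : ℝ) :
    Tendsto (fun i : ℕ => ((i : ℝ) + r) * (i + s) / (i : ℝ) ^ 2) atTop (nhds 1) := by
  have hinv : Tendsto (fun i : ℕ => ((i : ℝ))⁻¹) atTop (nhds 0) :=
    tendsto_inv_atTop_zero.comp tendsto_natCast_atTop_atTop
  have h := ((hinv.const_mul r).const_add 1).mul ((hinv.const_mul s).const_add 1)
  simp only [mul_zero, add_zero, mul_one] at h
  refine h.congr' ?_
  filter_upwards [eventually_gt_atTop 0] with i hi
  have : (i : ℝ) ≠ 0 := by exact_mod_cast hi.ne'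
  field_simp

/-! ### Families indexed by pairs, filtered by total degree. -/

section DegreeSpan

variable (K : Type*) [Field K] {M : Type*} [AddCommGroup M] [Module K M]

/-- The pairs of natural numbers with sum at most `n`. -/
def degreeFinset (n : ℕ) : Finset (ℕ × ℕ) :=
  (Finset.range (n + 1)).biUnion Finset.HasAntidiagonal.antidiagonal

theorem mem_degreeFinset {n : ℕ} {s : ℕ × ℕ} : s ∈ degreeFinset n ↔ s.1 + s.2 ≤ n := by
  simp [degreeFinset]

theorem two_mul_card_degreeFinset (n : ℕ) : 2 * (degreeFinset n).card = (n + 1) * (n + 2) := by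
  rw [degreeFinset, Finset.card_biUnion]
  · simp only [Finset.Nat.card_antidiagonal]
    induction n with
    | zero => simp
    | succ n ih =>
      rw [Finset.sum_range_succ, mul_add, ih]
      ring
  · intro i _ j _ hij
    rw [Function.onFun, Finset.disjoint_left]
    intro s hi hj
    rw [Finset.HasAntidiagonal.mem_antidiagonal] at hi hj
    exact hij (hi.symm.trans hj)

/-- The span of the members of degree at most `n` of a family indexed by pairs. -/
def degreeSpan (b : ℕ × ℕ → M) (n : ℕ) : Submodule K M :=
  Submodule.span K (b '' (degreeFinset n : Set (ℕ × ℕ)))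

variable (b : ℕ × ℕ → M)

theorem mem_degreeSpan {i j n : ℕ} (h : i + j ≤ n) : b (i, j) ∈ degreeSpan K b n :=
  Submodule.subset_span ⟨(i, j), Finset.mem_coe.mpr (mem_degreeFinset.mpr h), rfl⟩

theorem degreeSpan_le {n : ℕ} {N : Submodule K M} :
    degreeSpan K b n ≤ N ↔ ∀ i j, i + j ≤ n → b (i, j) ∈ N := by
  rw [degreeSpan, Submodule.span_le]
  constructor
  · exact fun h i j hij => h ⟨(i, j), Finset.mem_coe.mpr (mem_degreeFinset.mpr hij), rfl⟩
  · rintro h _ ⟨s, hs, rfl⟩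
    exact h s.1 s.2 (mem_degreeFinset.mp (Finset.mem_coe.mp hs))

theorem degreeSpan_mono : Monotone (degreeSpan K b) := fun _ _ hmn =>
  (degreeSpan_le K b).mpr fun _ _ hij => mem_degreeSpan K b (hij.trans hmn)

theorem degreeSpan_fg (n : ℕ) : (degreeSpan K b n).FG :=
  Submodule.fg_span ((degreeFinset n).finite_toSet.image b)

instance (n : ℕ) : Module.Finite K (degreeSpan K b n) :=
  Module.Finite.iff_fg.mpr (degreeSpan_fg K b n)

theorem two_mul_finrank_degreeSpan_le (n : ℕ) :
    2 * Module.finrank K (degreeSpan K b n) ≤ (n + 1) * (n + 2) := by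
  classical
  rw [← two_mul_card_degreeFinset, degreeSpan, ← Finset.coe_image]
  exact Nat.mul_le_mul_left 2 ((finrank_span_finset_le_card _).trans Finset.card_image_le)

variable {b} in
theorem two_mul_finrank_degreeSpan (hb : LinearIndependent K b) (n : ℕ) :
    2 * Module.finrank K (degreeSpan K b n) = (n + 1) * (n + 2) := by
  classical
  rw [← two_mul_card_degreeFinset, degreeSpan, ← Finset.coe_image, finrank_span_finset_eq_card,
    Finset.card_image_of_injective _ hb.injective]
  rw [Finset.coe_image]
  exact (hb.linearIndepOn _).id_image

variable {K b} in
theorem exists_mem_degreeSpan {u : M} (hu : u ∈ Submodule.span K (Set.range b)) :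
    ∃ n, u ∈ degreeSpan K b n := by
  induction hu using Submodule.span_induction with
  | mem u hu =>
    obtain ⟨⟨i, j⟩, rfl⟩ := hu
    exact ⟨i + j, mem_degreeSpan K b le_rfl⟩
  | zero => exact ⟨0, Submodule.zero_mem _⟩
  | add u v _ _ ihu ihv =>
    obtain ⟨m, hm⟩ := ihu
    obtain ⟨k, hk⟩ := ihv
    exact ⟨max m k, Submodule.add_mem _ (degreeSpan_mono K b (le_max_left m k) hm)
      (degreeSpan_mono K b (le_max_right m k) hk)⟩
  | smul c u _ ihu =>
    obtain ⟨m, hm⟩ := ihu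
    exact ⟨m, Submodule.smul_mem _ c hm⟩

end DegreeSpan

theorem mul_factorial_ne_zero {K : Type*} [Field K] [CharZero K] {c : K} (hc : c ≠ 0) (i j : ℕ) :
    c * (i.factorial * j.factorial) ≠ 0 :=
  mul_ne_zero hc (mul_ne_zero (Nat.cast_ne_zero.mpr i.factorial_ne_zero)
    (Nat.cast_ne_zero.mpr j.factorial_ne_zero))

/-! ### Modules on which `A_2` acts as on monomials in two variables. -/

section Ladder

open WeylAlgebra

variable {K : Type*} [Field K] {M : Type*} [AddCommGroup M] [Module K M]
  [Module (WeylAlgebra K 2) M]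

/-- A family `b` in an `A_2`-module on which `p₁`, `p₂` act as the multiplications by the variables
act on the monomials in two variables, and `q₁`, `q₂` act as the partial derivatives. Here
`1, p₁, p₂, q₁, q₂` span the same subspace of `A_2` as `1` and the generators. -/
structure IsLadder (p₁ p₂ q₁ q₂ : WeylAlgebra K 2) (b : ℕ × ℕ → M) : Prop where
  p₁_mem : p₁ ∈ generatorSpan K
  p₂_mem : p₂ ∈ generatorSpan K
  q₁_mem : q₁ ∈ generatorSpan K
  q₂_mem : q₂ ∈ generatorSpan K
  X_mem : ∀ i, X K 2 i ∈ Submodule.span K {1, p₁, p₂, q₁, q₂}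
  D_mem : ∀ i, D K 2 i ∈ Submodule.span K {1, p₁, p₂, q₁, q₂}
  p₁_smul : ∀ i j, p₁ • b (i, j) = b (i + 1, j)
  p₂_smul : ∀ i j, p₂ • b (i, j) = b (i, j + 1)
  q₁_smul : ∀ i j, q₁ • b (i, j) = (i : K) • b (i - 1, j)
  q₂_smul : ∀ i j, q₂ • b (i, j) = (j : K) • b (i, j - 1)
  ne_zero : b (0, 0) ≠ 0

namespace IsLadder

variable {p₁ p₂ q₁ q₂ : WeylAlgebra K 2} {b : ℕ × ℕ → M}

theorem generatorSpan_le (h : IsLadder p₁ p₂ q₁ q₂ b) :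
    generatorSpan K ≤ Submodule.span K {1, p₁, p₂, q₁, q₂} := by
  rw [generatorSpan, Submodule.span_le]
  rintro v (rfl | rfl | rfl | rfl | rfl)
  · exact Submodule.subset_span (by simp)
  · exact h.X_mem 0
  · exact h.X_mem 1
  · exact h.D_mem 0
  · exact h.D_mem 1

theorem eq_pow_smul (h : IsLadder p₁ p₂ q₁ q₂ b) (i j : ℕ) :
    b (i, j) = (p₁ ^ i * p₂ ^ j) • b (0, 0) := by
  have h2 : b (0, j) = p₂ ^ j • b (0, 0) := by
    induction j with
    | zero => simp
    | succ j ih => rw [pow_succ', mul_smul, ← ih, h.p₂_smul]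
  rw [mul_smul, ← h2]
  induction i with
  | zero => simp
  | succ i ih => rw [pow_succ', mul_smul, ← ih, h.p₁_smul]

theorem apply_mem (h : IsLadder p₁ p₂ q₁ q₂ b) {N : Submodule (WeylAlgebra K 2) M}
    (hN : b (0, 0) ∈ N) (s : ℕ × ℕ) : b s ∈ N := by
  rw [← Prod.mk.eta (p := s), h.eq_pow_smul]
  exact N.smul_mem _ hN

variable [IsScalarTower K (WeylAlgebra K 2) M]

theorem q₁_pow_smul (h : IsLadder p₁ p₂ q₁ q₂ b) (n i j : ℕ) :
    q₁ ^ n • b (i, j) = (i.descFactorial n : K) • b (i - n, j) := by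
  induction n with
  | zero => simp
  | succ n ih =>
    rw [pow_succ', mul_smul, ih, smul_algebra_smul_comm, h.q₁_smul, smul_smul,
      Nat.descFactorial_succ, Nat.sub_sub, mul_comm (i - n)]
    push_cast
    rfl

theorem q₂_pow_smul (h : IsLadder p₁ p₂ q₁ q₂ b) (n i j : ℕ) :
    q₂ ^ n • b (i, j) = (j.descFactorial n : K) • b (i, j - n) := by
  induction n with
  | zero => simp
  | succ n ih =>
    rw [pow_succ', mul_smul, ih, smul_algebra_smul_comm, h.q₂_smul, smul_smul,
      Nat.descFactorial_succ, Nat.sub_sub, mul_comm (j - n)]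
    push_cast
    rfl

theorem q_pow_smul (h : IsLadder p₁ p₂ q₁ q₂ b) (m n i j : ℕ) :
    (q₁ ^ m * q₂ ^ n) • b (i, j) =
      ((i.descFactorial m : K) * j.descFactorial n) • b (i - m, j - n) := by
  rw [mul_smul, h.q₂_pow_smul, smul_algebra_smul_comm, h.q₁_pow_smul, smul_smul, mul_comm]

/-- Lowering a linear combination by an exponent of maximal degree. -/
theorem exists_lowering (h : IsLadder p₁ p₂ q₁ q₂ b) {c : ℕ × ℕ →₀ K} (hc : c ≠ 0) :
    ∃ s : ℕ × ℕ, c s ≠ 0 ∧ (q₁ ^ s.1 * q₂ ^ s.2) • Finsupp.linearCombination K b c =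
      (c s * (s.1.factorial * s.2.factorial)) • b (0, 0) := by
  obtain ⟨s, hs, hmax⟩ := Finset.exists_max_image c.support (fun s => s.1 + s.2)
    (Finsupp.support_nonempty_iff.mpr hc)
  refine ⟨s, Finsupp.mem_support_iff.mp hs, ?_⟩
  rw [Finsupp.linearCombination_apply, Finsupp.sum, Finset.smul_sum, Finset.sum_eq_single s]
  · rw [smul_algebra_smul_comm, h.q_pow_smul]
    simp [smul_smul, Nat.descFactorial_self]
  · rintro ⟨i, j⟩ ht hne
    rw [smul_algebra_smul_comm, h.q_pow_smul]
    have hle := hmax _ ht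
    -- An exponent dominating `s` in both coordinates would equal `s` by maximality of the degree.
    -- Every other term is therefore differentiated to zero, through a vanishing descending
    -- factorial.
    have : i < s.1 ∨ j < s.2 := by
      by_contra! hcon
      apply hne
      ext <;> dsimp only at * <;> omega
    rcases this with hlt | hlt <;> simp [Nat.descFactorial_of_lt hlt]
  · exact fun h => absurd hs h

theorem mem_of_mem (h : IsLadder p₁ p₂ q₁ q₂ b) (hspan : Submodule.span K (Set.range b) = ⊤)
    {N : Submodule (WeylAlgebra K 2) M} (hN : b (0, 0) ∈ N) (u : M) : u ∈ N := by
  have hle : Submodule.span K (Set.range b) ≤ N.restrictScalars K :=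
    Submodule.span_le.mpr (by rintro _ ⟨s, rfl⟩; exact h.apply_mem hN s)
  exact hle (hspan ▸ Submodule.mem_top)

theorem generatorSpan_smul_degreeSpan_le (h : IsLadder p₁ p₂ q₁ q₂ b) (n : ℕ) :
    generatorSpan K • degreeSpan K b n ≤ degreeSpan K b (n + 1) := by
  refine (Submodule.smul_mono_left h.generatorSpan_le).trans ?_
  refine span_smul_span_le ?_
  rintro v hv _ ⟨⟨i, j⟩, hs, rfl⟩
  have hs' : i + j ≤ n := mem_degreeFinset.mp (Finset.mem_coe.mp hs)
  rcases hv with rfl | rfl | rfl | rfl | rfl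
  · simpa using mem_degreeSpan K b (by omega)
  · simpa [h.p₁_smul] using mem_degreeSpan K b (by omega)
  · simpa [h.p₂_smul] using mem_degreeSpan K b (by omega)
  · simpa [h.q₁_smul] using Submodule.smul_mem _ _ (mem_degreeSpan K b (by omega))
  · simpa [h.q₂_smul] using Submodule.smul_mem _ _ (mem_degreeSpan K b (by omega))

/-- Raising the bottom vector reaches every `b (i, j)` in `i + j` steps, and no generator increases
the degree by more than one. Growth thus reduces to counting pairs of exponents. -/
theorem generatorSpan_pow_smul_span (h : IsLadder p₁ p₂ q₁ q₂ b) (n : ℕ) :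
    generatorSpan K ^ n • Submodule.span K {b (0, 0)} = degreeSpan K b n := by
  apply le_antisymm
  · have h0 : Submodule.span K {b (0, 0)} ≤ degreeSpan K b 0 := by
      rw [Submodule.span_singleton_le_iff_mem]
      exact mem_degreeSpan K b le_rfl
    refine (Submodule.smul_mono le_rfl h0).trans ?_
    simpa using generatorSpan_pow_smul_le h.generatorSpan_smul_degreeSpan_le n 0
  · rw [degreeSpan_le]
    intro i j hij
    rw [h.eq_pow_smul i j]
    have hmem : p₁ ^ i * p₂ ^ j ∈ generatorSpan K ^ (i + j) := by
      rw [pow_add]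
      exact Submodule.mul_mem_mul (Submodule.pow_mem_pow _ h.p₁_mem i)
        (Submodule.pow_mem_pow _ h.p₂_mem j)
    have hb : b (0, 0) ∈ Submodule.span K {b (0, 0)} := Submodule.mem_span_singleton_self _
    exact Submodule.smul_mem_smul (generatorSpan_pow_mono K hij hmem) hb

variable [CharZero K]

/-- A nontrivial relation would be lowered to a nonzero multiple of the bottom vector. -/
theorem linearIndependent (h : IsLadder p₁ p₂ q₁ q₂ b) : LinearIndependent K b := by
  rw [linearIndependent_iff]
  intro c hc
  by_contra hne
  obtain ⟨s, hs, hlow⟩ := h.exists_lowering hne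
  rw [hc, smul_zero] at hlow
  exact smul_ne_zero (mul_factorial_ne_zero hs _ _) h.ne_zero hlow.symm

theorem apply_ne_zero (h : IsLadder p₁ p₂ q₁ q₂ b) (s : ℕ × ℕ) : b s ≠ 0 :=
  h.linearIndependent.ne_zero s

theorem two_le_gkDim (h : IsLadder p₁ p₂ q₁ q₂ b) :
    ((2 : ℕ) : EReal) ≤ gkDim K (WeylAlgebra K 2) M := by
  refine IntDiff.two_le_gkDim (W := Submodule.span K {b (0, 0)})
    (Submodule.fg_span (Set.finite_singleton _)) fun i => ?_
  rw [h.generatorSpan_pow_smul_span, two_mul_finrank_degreeSpan K h.linearIndependent]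

theorem isHolonomic (h : IsLadder p₁ p₂ q₁ q₂ b)
    (hspan : Submodule.span K (Set.range b) = ⊤) : IsHolonomic K 2 M := by
  have hmem : ∀ u, u ∈ Submodule.span K (Set.range b) := fun u => hspan ▸ Submodule.mem_top
  constructor
  · refine ⟨⟨{b (0, 0)}, ?_⟩⟩
    rw [Finset.coe_singleton, eq_top_iff]
    rintro u -
    exact h.mem_of_mem hspan (Submodule.mem_span_singleton_self _) u
  · refine le_antisymm (gkDim_le_two (degreeSpan_mono K b) (fun u => exists_mem_degreeSpan (hmem u))
      h.generatorSpan_smul_degreeSpan_le (degreeSpan_fg K b) 1 fun i => ?_) h.two_le_gkDim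
    have := two_mul_finrank_degreeSpan_le K b i
    nlinarith

/-- A generating subspace `W` lies in some degree `a`, and the bottom vector lies in `G^d W` for
some `d`, where `G` is the generator span. Hence `G^i W` is squeezed between the parts of degree at
most `i - d` and `i + a`, both of dimension `i² / 2 + O(i)`. -/
theorem hasMultiplicity (h : IsLadder p₁ p₂ q₁ q₂ b)
    (hspan : Submodule.span K (Set.range b) = ⊤) : HasMultiplicity K 2 M 1 := by
  have hmem : ∀ u, u ∈ Submodule.span K (Set.range b) := fun u => hspan ▸ Submodule.mem_top
  refine ⟨h.isHolonomic hspan, fun W hW hgen => ?_⟩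
  obtain ⟨a, ha⟩ :=
    exists_le_of_fg K (degreeSpan_mono K b) (fun u => exists_mem_degreeSpan (hmem u)) hW
  obtain ⟨d, hd⟩ := exists_mem_generatorSpan_pow_smul (K := K) (W := W) (u := b (0, 0))
    (hgen ▸ Submodule.mem_top)
  have hupper (i : ℕ) : generatorSpan K ^ i • W ≤ degreeSpan K b (a + i) :=
    (Submodule.smul_mono le_rfl ha).trans
      (generatorSpan_pow_smul_le h.generatorSpan_smul_degreeSpan_le i a)
  have hlower (i : ℕ) : degreeSpan K b i ≤ generatorSpan K ^ (i + d) • W := by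
    rw [← h.generatorSpan_pow_smul_span, pow_add, ← smul_eq_mul, Submodule.smul_assoc]
    exact Submodule.smul_mono le_rfl ((Submodule.span_singleton_le_iff_mem _ _).mpr hd)
  have hfin (i : ℕ) : Module.Finite K ↥(generatorSpan K ^ i • W) :=
    Submodule.finiteDimensional_of_le (hupper i)
  have hupper' (i : ℕ) : 2 * Module.finrank K ↥(generatorSpan K ^ i • W) ≤
      (a + i + 1) * (a + i + 2) := by
    rw [← two_mul_finrank_degreeSpan K h.linearIndependent]
    exact Nat.mul_le_mul_left 2 (Submodule.finrank_mono (hupper i))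
  have hlower' (i : ℕ) : (i + 1) * (i + 2) ≤
      2 * Module.finrank K ↥(generatorSpan K ^ (i + d) • W) := by
    rw [← two_mul_finrank_degreeSpan K h.linearIndependent]
    exact Nat.mul_le_mul_left 2 (Submodule.finrank_mono (hlower i))
  simp only [Nat.factorial_two, Nat.cast_ofNat, Nat.cast_one]
  refine tendsto_of_tendsto_of_tendsto_of_le_of_le' (tendsto_mul_div_sq (1 - d) (2 - d))
    (tendsto_mul_div_sq (a + 1) (a + 2)) ?_ ?_
  · filter_upwards [Filter.eventually_ge_atTop d] with i hi
    -- Writing `i = k + d` avoids truncated subtraction: the lower bound `(k + 1)(k + 2)` is `(i + 1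
    -- - d)(i + 2 - d)`.
    obtain ⟨k, rfl⟩ := Nat.exists_eq_add_of_le' hi
    refine div_le_div_of_nonneg_right ?_ (by positivity)
    have : ((k : ℝ) + 1) * (k + 2) ≤ 2 * Module.finrank K ↥(generatorSpan K ^ (k + d) • W) := by
      exact_mod_cast hlower' k
    rw [bernstein_eq_generatorSpan_pow]
    push_cast
    linarith
  · filter_upwards with i
    refine div_le_div_of_nonneg_right ?_ (by positivity)
    have : 2 * (Module.finrank K ↥(generatorSpan K ^ i • W) : ℝ) ≤ (a + i + 1) * (a + i + 2) := by
      exact_mod_cast hupper' i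
    rw [bernstein_eq_generatorSpan_pow]
    linarith

theorem apply_zero_mem_of_mem (h : IsLadder p₁ p₂ q₁ q₂ b)
    (hspan : Submodule.span K (Set.range b) = ⊤) {u : M} (hu : u ≠ 0)
    {N : Submodule (WeylAlgebra K 2) M} (hN : u ∈ N) : b (0, 0) ∈ N := by
  obtain ⟨c, rfl⟩ := (Finsupp.mem_span_range_iff_exists_finsupp (R := K) (v := b)).mp
    (hspan ▸ Submodule.mem_top : u ∈ _)
  have hc : c ≠ 0 := by
    rintro rfl
    simp at hu
  obtain ⟨s, hs, hlow⟩ := h.exists_lowering hc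
  rw [Finsupp.linearCombination_apply] at hlow
  have hk := mul_factorial_ne_zero hs s.1 s.2
  have hmem := (N.restrictScalars K).smul_mem (c s * (s.1.factorial * s.2.factorial))⁻¹
    (N.smul_mem (q₁ ^ s.1 * q₂ ^ s.2) hN)
  rwa [hlow, smul_smul, inv_mul_cancel₀ hk, one_smul] at hmem

/-- A nonzero submodule contains the bottom vector by lowering, and then everything by raising. -/
theorem isSimpleModule (h : IsLadder p₁ p₂ q₁ q₂ b)
    (hspan : Submodule.span K (Set.range b) = ⊤) : IsSimpleModule (WeylAlgebra K 2) M := by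
  have : Nontrivial M := ⟨⟨b (0, 0), 0, h.ne_zero⟩⟩
  rw [isSimpleModule_iff]
  refine { eq_bot_or_eq_top := fun N => or_iff_not_imp_left.mpr fun hN => ?_ }
  obtain ⟨u, huN, hu⟩ := Submodule.exists_mem_ne_zero_of_ne_bot hN
  exact eq_top_iff.mpr fun v _ => h.mem_of_mem hspan (h.apply_zero_mem_of_mem hspan hu huN) v

/-- The elements killed by both lowering operators. -/
theorem exists_eq_smul (h : IsLadder p₁ p₂ q₁ q₂ b) (hspan : Submodule.span K (Set.range b) = ⊤)
    {u : M} (h₁ : q₁ • u = 0) (h₂ : q₂ • u = 0) : ∃ k : K, u = k • b (0, 0) := by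
  obtain ⟨c, rfl⟩ := (Finsupp.mem_span_range_iff_exists_finsupp (R := K) (v := b)).mp
    (hspan ▸ Submodule.mem_top : u ∈ _)
  rw [← Finsupp.linearCombination_apply] at h₁ h₂ ⊢
  refine ⟨c (0, 0), ?_⟩
  have hq₁ : q₁ • b (0, 0) = 0 := by simp [h.q₁_smul]
  have hq₂ : q₂ • b (0, 0) = 0 := by simp [h.q₂_smul]
  -- The bottom term is removed; the remainder is still killed by `q₁` and `q₂`. If it were nonzero,
  -- the exponent used to lower it would not be `(0, 0)`, so one of these operators would act first
  -- and give zero.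
  set c' := c - Finsupp.single (0, 0) (c (0, 0)) with hc'
  have hlc : Finsupp.linearCombination K b c' =
      Finsupp.linearCombination K b c - c (0, 0) • b (0, 0) := by
    rw [hc', map_sub, Finsupp.linearCombination_single]
  have h₁' : q₁ • Finsupp.linearCombination K b c' = 0 := by
    rw [hlc, smul_sub, h₁, smul_algebra_smul_comm, hq₁, smul_zero, sub_zero]
  have h₂' : q₂ • Finsupp.linearCombination K b c' = 0 := by
    rw [hlc, smul_sub, h₂, smul_algebra_smul_comm, hq₂, smul_zero, sub_zero]
  suffices hzero : c' = 0 by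
    rw [hzero, map_zero] at hlc
    exact sub_eq_zero.mp hlc.symm
  by_contra hne
  obtain ⟨⟨i, j⟩, hs, hlow⟩ := h.exists_lowering hne
  refine smul_ne_zero (mul_factorial_ne_zero hs i j) h.ne_zero (hlow.symm.trans ?_)
  rcases j with _ | j
  · rcases i with _ | i
    · simp [hc'] at hs
    · rw [pow_zero, mul_one, pow_succ, mul_smul, h₁', smul_zero]
  · rw [pow_succ, mul_smul, mul_smul, h₂', smul_zero, smul_zero]

/-- An endomorphism sends the bottom vector to a vector killed by both lowering operators, hence to
a scalar multiple of it. The bottom vector generates the module, so the endomorphism is that scalar.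
-/
theorem nonempty_end_algEquiv (h : IsLadder p₁ p₂ q₁ q₂ b)
    (hspan : Submodule.span K (Set.range b) = ⊤) :
    Nonempty (Module.End (WeylAlgebra K 2) M ≃ₐ[K] K) := by
  refine ⟨(AlgEquiv.ofBijective (Algebra.ofId K (Module.End (WeylAlgebra K 2) M)) ⟨?_, ?_⟩).symm⟩
  · intro k l hkl
    have := LinearMap.congr_fun hkl (b (0, 0))
    simp only [Algebra.ofId_apply, Module.algebraMap_end_apply] at this
    exact smul_left_injective K h.ne_zero this
  · intro φ
    obtain ⟨k, hk⟩ := h.exists_eq_smul hspan (u := φ (b (0, 0)))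
      (by rw [← map_smul, h.q₁_smul]; simp) (by rw [← map_smul, h.q₂_smul]; simp)
    refine ⟨k, ?_⟩
    have hker := h.mem_of_mem hspan (N := LinearMap.ker
      (Algebra.ofId K (Module.End (WeylAlgebra K 2) M) k - φ)) (by simp [hk])
    exact sub_eq_zero.mp (LinearMap.ext fun u => hker u)

/-- Modules spanned by ladders for the same operators are isomorphic. -/
theorem nonempty_linearEquiv (h : IsLadder p₁ p₂ q₁ q₂ b)
    (hspan : Submodule.span K (Set.range b) = ⊤) {M' : Type*} [AddCommGroup M'] [Module K M']
    [Module (WeylAlgebra K 2) M'] [IsScalarTower K (WeylAlgebra K 2) M'] {b' : ℕ × ℕ → M'}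
    (h' : IsLadder p₁ p₂ q₁ q₂ b') (hspan' : Submodule.span K (Set.range b') = ⊤) :
    Nonempty (M ≃ₗ[WeylAlgebra K 2] M') := by
  let e : M ≃ₗ[K] M' := (Module.Basis.mk h.linearIndependent hspan.ge).equiv
    (Module.Basis.mk h'.linearIndependent hspan'.ge) (Equiv.refl _)
  have he (s : ℕ × ℕ) : e (b s) = b' s := by
    have := (Module.Basis.mk h.linearIndependent hspan.ge).equiv_apply s
      (Module.Basis.mk h'.linearIndependent hspan'.ge) (Equiv.refl _)
    simpa using this
  have hcomm : ∀ v ∈ generatorSpan K, ∀ u, e (v • u) = v • e u := by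
    intro v hv u
    have hu : u ∈ Submodule.span K (Set.range b) := hspan ▸ Submodule.mem_top
    replace hv := h.generatorSpan_le hv
    induction hv, hu using Submodule.span_induction₂ with
    | mem_mem v u hv hu =>
      obtain ⟨⟨i, j⟩, rfl⟩ := hu
      rcases hv with rfl | rfl | rfl | rfl | rfl
      · simp
      · rw [h.p₁_smul, he, he, h'.p₁_smul]
      · rw [h.p₂_smul, he, he, h'.p₂_smul]
      · rw [h.q₁_smul, map_smul, he, he, h'.q₁_smul]
      · rw [h.q₂_smul, map_smul, he, he, h'.q₂_smul]
    | zero_left u _ => simp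
    | zero_right a _ => simp
    | add_left a a' u _ _ _ h h' => rw [add_smul, add_smul, map_add, h, h']
    | add_right a u u' _ _ _ h h' => rw [smul_add, map_add, map_add, smul_add, h, h']
    | smul_left c a u _ _ h => rw [smul_assoc, smul_assoc, map_smul, h]
    | smul_right c a u _ _ h =>
      rw [smul_algebra_smul_comm, e.map_smul, e.map_smul, smul_algebra_smul_comm, h]
  have hall (a : WeylAlgebra K 2) (u : M) : e (a • u) = a • e u := by
    -- Linearity over all of `A_2` means that the graph of `e` is stable under `A_2`, and this needs
    -- checking only on the generators.
    have hgraph := smul_mem_of_generators (K := K) (M := M × M') e.toLinearMap.graph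
      (fun i m hm => by
        rw [LinearMap.mem_graph_iff] at hm ⊢
        simp [hm, hcomm _ (X_mem_generatorSpan K i)])
      (fun i m hm => by
        rw [LinearMap.mem_graph_iff] at hm ⊢
        simp [hm, hcomm _ (D_mem_generatorSpan K i)])
      a (m := (u, e u)) (by simp)
    rw [LinearMap.mem_graph_iff] at hgraph
    simpa using hgraph.symm
  exact ⟨{ e with map_smul' := hall }⟩

end IsLadder
end Ladder

/-! ### Ladders inside submodules. -/

section Restrict

variable {K : Type*} [Field K] {M : Type*} [AddCommGroup M] [Module K M]
  [Module (WeylAlgebra K 2) M] [IsScalarTower K (WeylAlgebra K 2) M]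

theorem IsLadder.restrict {p₁ p₂ q₁ q₂ : WeylAlgebra K 2} {b : ℕ × ℕ → M}
    (h : IsLadder p₁ p₂ q₁ q₂ b) (N : Submodule (WeylAlgebra K 2) M) (hN : ∀ s, b s ∈ N) :
    IsLadder p₁ p₂ q₁ q₂ fun s => (⟨b s, hN s⟩ : N) where
  __ := h
  p₁_smul i j := Subtype.ext (h.p₁_smul i j)
  p₂_smul i j := Subtype.ext (h.p₂_smul i j)
  q₁_smul i j := Subtype.ext (h.q₁_smul i j)
  q₂_smul i j := Subtype.ext (h.q₂_smul i j)
  ne_zero h0 := h.ne_zero (congrArg Subtype.val h0)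

theorem span_range_restrict {b : ℕ × ℕ → M} {N : Submodule (WeylAlgebra K 2) M}
    (hN : ∀ s, b s ∈ N) (hspan : Submodule.span K (Set.range b) = N.restrictScalars K) :
    Submodule.span K (Set.range fun s => (⟨b s, hN s⟩ : N)) = ⊤ := by
  refine Submodule.map_injective_of_injective
    (f := (N.subtype.restrictScalars K)) Subtype.val_injective ?_
  rw [Submodule.map_span, ← Set.range_comp, Submodule.map_top]
  refine hspan.trans ?_
  ext u
  simp

theorem IsLadder.span_le {p₁ p₂ q₁ q₂ : WeylAlgebra K 2} {b : ℕ × ℕ → M}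
    (h : IsLadder p₁ p₂ q₁ q₂ b) {v : WeylAlgebra K 2} (hv : v ∈ WeylAlgebra.generatorSpan K)
    {u : M} (hu : u ∈ Submodule.span K (Set.range b)) :
    v • u ∈ Submodule.span K (Set.range b) := by
  obtain ⟨n, hn⟩ := exists_mem_degreeSpan hu
  exact Submodule.span_mono (Set.image_subset_range _ _)
    (h.generatorSpan_smul_degreeSpan_le n (Submodule.smul_mem_smul hv hn))

end Restrict

/-! ### The three families in `𝕀_1`. -/

section Families

open WeylAlgebra

variable (K : Type*) [Field K]

/-- The elements `i! e_{ij}` of `F`. -/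
def ladderF (s : ℕ × ℕ) : I1 K := (s.1.factorial : K) • I1.e K s.1 s.2

/-- The elements `x^i ∂^j` of `A_1`. -/
def ladderA (s : ℕ × ℕ) : I1 K := I1.x K ^ s.1 * I1.d K ^ s.2

/-- The elements `x^i ∫ x^j` of `𝕀_1`. -/
def ladderInt (s : ℕ × ℕ) : I1 K := I1.x K ^ s.1 * I1.int K * I1.x K ^ s.2

theorem I1.d_mul_x_pow (n : ℕ) :
    I1.d K * I1.x K ^ n = I1.x K ^ n * I1.d K + (n : K) • I1.x K ^ (n - 1) :=
  mul_pow_of_mul_eq_add_one (I1.d_mul_x K) n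

theorem I1.d_pow_mul_x (n : ℕ) :
    I1.d K ^ n * I1.x K = I1.x K * I1.d K ^ n + (n : K) • I1.d K ^ (n - 1) :=
  pow_mul_of_mul_eq_add_one (I1.d_mul_x K) n

/-- The operator `e_{00} = 1 - ∫∂` fixes the constant polynomial `1`. -/
theorem I1.e_zero_zero_ne_zero : I1.e K 0 0 ≠ 0 := by
  intro h
  have h1 := LinearMap.congr_fun (congrArg (I1.toEnd K) h) 1
  simp [I1.e, I1.toEnd_int, I1.toEnd_d, opD] at h1

/-- The lowering operators are commutators: `(∂_1 - x_2) u = ∂u - u∂` and `(∂_2 - x_1) u = ux - xu`.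
On `x^i ∂^j` they differentiate formally in `x` and in `∂`. -/
theorem isLadder_ladderA :
    IsLadder (X K 2 0) (X K 2 1) (D K 2 0 - X K 2 1) (D K 2 1 - X K 2 0) (ladderA K) where
  p₁_mem := X_mem_generatorSpan K 0
  p₂_mem := X_mem_generatorSpan K 1
  q₁_mem := Submodule.sub_mem _ (D_mem_generatorSpan K 0) (X_mem_generatorSpan K 1)
  q₂_mem := Submodule.sub_mem _ (D_mem_generatorSpan K 1) (X_mem_generatorSpan K 0)
  X_mem i := by fin_cases i <;> exact Submodule.subset_span (by simp)
  D_mem := by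
    have h {a c : WeylAlgebra K 2} {S : Set (WeylAlgebra K 2)} (ha : a - c ∈ S) (hc : c ∈ S) :
        a ∈ Submodule.span K S := by
      simpa using Submodule.add_mem _ (Submodule.subset_span (R := K) ha)
        (Submodule.subset_span hc)
    exact Fin.forall_fin_two.mpr ⟨h (c := X K 2 1) (by simp) (by simp),
      h (c := X K 2 0) (by simp) (by simp)⟩
  p₁_smul i j := by simp only [ladderA, I1.X_zero_smul, pow_succ', mul_assoc]
  p₂_smul i j := by simp only [ladderA, I1.X_one_smul, pow_succ, mul_assoc]
  q₁_smul i j := by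
    rw [sub_smul, I1.D_zero_smul, I1.X_one_smul, ladderA, ← mul_assoc, I1.d_mul_x_pow, add_mul,
      mul_assoc, mul_assoc, ← pow_succ, ← pow_succ', add_sub_cancel_left, smul_mul_assoc, ladderA]
  q₂_smul i j := by
    rw [sub_smul, I1.D_one_smul, I1.X_zero_smul, ladderA, mul_assoc, I1.d_pow_mul_x, mul_add,
      ← mul_assoc, ← mul_assoc, ← pow_succ, ← pow_succ', add_sub_cancel_left, mul_smul_comm,
      ladderA]
  ne_zero := by
    intro h
    have h1 := LinearMap.congr_fun (congrArg (I1.toEnd K) h) 1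
    simp [ladderA] at h1

theorem span_ladderA :
    Submodule.span K (Set.range (ladderA K)) = (A1Sub K).restrictScalars K := by
  apply le_antisymm
  · rw [Submodule.span_le]
    rintro _ ⟨s, rfl⟩
    exact (A1 K).mul_mem ((A1 K).pow_mem (A1.x_mem K) _) ((A1 K).pow_mem (A1.d_mem K) _)
  · intro a ha
    have hone : (1 : I1 K) ∈ Submodule.span K (Set.range (ladderA K)) :=
      Submodule.subset_span ⟨(0, 0), by simp [ladderA]⟩
    rw [← mul_one a]
    refine mul_mem_of_mem_adjoin (s := {I1.x K, I1.d K}) ?_ ha hone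
    rintro _ (rfl | rfl) u hu
    · rw [← I1.X_zero_smul]
      exact (isLadder_ladderA K).span_le (X_mem_generatorSpan K 0) hu
    · rw [← I1.D_zero_smul]
      exact (isLadder_ladderA K).span_le (D_mem_generatorSpan K 0) hu

theorem ladderA_mem (s : ℕ × ℕ) : ladderA K s ∈ A1Sub K :=
  (A1 K).mul_mem ((A1 K).pow_mem (A1.x_mem K) _) ((A1 K).pow_mem (A1.d_mem K) _)

theorem I1.int_mul_d : I1.int K * I1.d K = 1 - I1.e K 0 0 := by simp [I1.e]

theorem I1.x_mul_ladderInt (i j : ℕ) : I1.x K * ladderInt K (i, j) = ladderInt K (i + 1, j) := by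
  simp only [ladderInt, pow_succ', mul_assoc]

theorem I1.ladderInt_mul_x (i j : ℕ) : ladderInt K (i, j) * I1.x K = ladderInt K (i, j + 1) := by
  simp only [ladderInt, pow_succ, mul_assoc]

variable [CharZero K]

/-- The factor `i!` absorbs the coefficient in `x e_{ij} = (i + 1) e_{i+1,j}` and produces the
coefficient `i` required of `∂_1`. -/
theorem isLadder_ladderF :
    IsLadder (X K 2 0) (X K 2 1) (D K 2 0) (D K 2 1) (ladderF K) where
  p₁_mem := X_mem_generatorSpan K 0
  p₂_mem := X_mem_generatorSpan K 1
  q₁_mem := D_mem_generatorSpan K 0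
  q₂_mem := D_mem_generatorSpan K 1
  X_mem i := by fin_cases i <;> exact Submodule.subset_span (by simp)
  D_mem i := by fin_cases i <;> exact Submodule.subset_span (by simp)
  p₁_smul i j := by
    simp only [ladderF, I1.X_zero_smul, mul_smul_comm, I1.x_mul_e, smul_smul, Nat.factorial_succ]
    push_cast
    rw [mul_comm]
  p₂_smul i j := by simp only [ladderF, I1.X_one_smul, smul_mul_assoc, I1.e_mul_d]
  q₁_smul i j := by
    simp only [ladderF, I1.D_zero_smul, mul_smul_comm]
    rcases i with _ | i
    · simp [I1.d_mul_e_zero]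
    · rw [I1.d_mul_e_succ, smul_smul, Nat.add_sub_cancel, Nat.factorial_succ]
      push_cast
      rfl
  q₂_smul i j := by
    simp only [ladderF, I1.D_one_smul, smul_mul_assoc, I1.e_mul_x]
    rw [smul_comm]
  ne_zero := by simpa [ladderF] using I1.e_zero_zero_ne_zero K

theorem span_ladderF :
    Submodule.span K (Set.range (ladderF K)) = (FSub K).restrictScalars K := by
  change _ = F K
  apply le_antisymm
  · rw [Submodule.span_le]
    rintro _ ⟨s, rfl⟩
    exact (F K).smul_mem _ (F.e_mem K _ _)
  · rw [F, Submodule.span_le]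
    rintro _ ⟨s, rfl⟩
    have h : (s.1.factorial : K) ≠ 0 := Nat.cast_ne_zero.mpr s.1.factorial_ne_zero
    have := Submodule.smul_mem (Submodule.span K (Set.range (ladderF K))) (s.1.factorial : K)⁻¹
      (Submodule.subset_span ⟨s, rfl⟩)
    rwa [ladderF, smul_smul, inv_mul_cancel₀ h, one_smul] at this

theorem ladderF_mem (s : ℕ × ℕ) : ladderF K s ∈ FSub K := (F K).smul_mem _ (F.e_mem K _ _)

theorem I1.d_mul_ladderInt (i j : ℕ) :
    I1.d K * ladderInt K (i, j) = (i : K) • ladderInt K (i - 1, j) + ladderA K (i + j, 0) := by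
  simp only [ladderInt, ladderA, ← mul_assoc, I1.d_mul_x_pow, add_mul, smul_mul_assoc, pow_zero,
    mul_one]
  rw [mul_assoc _ (I1.d K), I1.d_mul_int, mul_one, pow_add, add_comm]

theorem I1.e_zero_zero_mul_x_pow (j : ℕ) :
    I1.e K 0 0 * I1.x K ^ j = if j = 0 then I1.e K 0 0 else 0 := by
  rcases j with _ | j
  · simp
  · simp [pow_succ', ← mul_assoc, I1.e_mul_x]

theorem I1.x_pow_mul_e_zero_zero (i : ℕ) : I1.x K ^ i * I1.e K 0 0 = ladderF K (i, 0) := by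
  induction i with
  | zero => simp [ladderF]
  | succ i ih => rw [pow_succ', mul_assoc, ih, ← I1.X_zero_smul, (isLadder_ladderF K).p₁_smul]

/-- Moving `∂` to the left of `x^j` creates `∫∂ = 1 - e_{00}`. Since `e_{00} x = 0`, the correction
in `F` survives only for `j = 0`; it and the `A_1` term vanish in the quotient. -/
theorem I1.ladderInt_mul_d (i j : ℕ) : ladderInt K (i, j) * I1.d K =
    ladderA K (i + j, 0) - (if j = 0 then ladderF K (i, 0) else 0) -
      (j : K) • ladderInt K (i, j - 1) := by
  have h : I1.x K ^ j * I1.d K = I1.d K * I1.x K ^ j - (j : K) • I1.x K ^ (j - 1) := by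
    rw [I1.d_mul_x_pow, add_sub_cancel_right]
  have h2 : I1.x K ^ i * I1.int K * (I1.d K * I1.x K ^ j) =
      I1.x K ^ i * (I1.int K * I1.d K * I1.x K ^ j) := by simp only [mul_assoc]
  simp only [ladderInt, ladderA]
  rw [mul_assoc, h, mul_sub, mul_smul_comm, h2, I1.int_mul_d, sub_mul, one_mul, mul_sub,
    I1.e_zero_zero_mul_x_pow, pow_zero, mul_one, ← pow_add]
  split_ifs <;> simp [I1.x_pow_mul_e_zero_zero]

end Families

/-! ### Local nilpotence as an isomorphism invariant. -/

section LocallyNilpotent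

variable {K : Type*} [Field K] {M : Type*} [AddCommGroup M] [Module K M]
  [Module (WeylAlgebra K 2) M] [IsScalarTower K (WeylAlgebra K 2) M]

theorem exists_pow_smul_eq_zero {q : WeylAlgebra K 2} {b : ℕ × ℕ → M}
    (hb : ∀ s, ∃ n, q ^ n • b s = 0) {u : M} (hu : u ∈ Submodule.span K (Set.range b)) :
    ∃ n, q ^ n • u = 0 := by
  have hmono {u : M} {m n : ℕ} (hmn : m ≤ n) (hu : q ^ m • u = 0) : q ^ n • u = 0 := by
    rw [← Nat.sub_add_cancel hmn, pow_add, mul_smul, hu, smul_zero]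
  induction hu using Submodule.span_induction with
  | mem u hu => obtain ⟨s, rfl⟩ := hu; exact hb s
  | zero => exact ⟨0, smul_zero _⟩
  | add u v _ _ ihu ihv =>
    obtain ⟨m, hm⟩ := ihu
    obtain ⟨n, hn⟩ := ihv
    exact ⟨max m n, by rw [smul_add, hmono (le_max_left m n) hm, hmono (le_max_right m n) hn,
      add_zero]⟩
  | smul c u _ ih =>
    obtain ⟨n, hn⟩ := ih
    exact ⟨n, by rw [smul_algebra_smul_comm, hn, smul_zero]⟩

variable {p₁ p₂ q₁ q₂ : WeylAlgebra K 2} {b : ℕ × ℕ → M}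

theorem IsLadder.exists_q₁_pow_smul_eq_zero (h : IsLadder p₁ p₂ q₁ q₂ b) {u : M}
    (hu : u ∈ Submodule.span K (Set.range b)) : ∃ n, q₁ ^ n • u = 0 :=
  exists_pow_smul_eq_zero (fun s => ⟨s.1 + 1, by
    rw [← Prod.mk.eta (p := s), h.q₁_pow_smul, Nat.descFactorial_of_lt (Nat.lt_succ_self _),
      Nat.cast_zero, zero_smul]⟩) hu

theorem IsLadder.exists_q₂_pow_smul_eq_zero (h : IsLadder p₁ p₂ q₁ q₂ b) {u : M}
    (hu : u ∈ Submodule.span K (Set.range b)) : ∃ n, q₂ ^ n • u = 0 :=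
  exists_pow_smul_eq_zero (fun s => ⟨s.2 + 1, by
    rw [← Prod.mk.eta (p := s), h.q₂_pow_smul, Nat.descFactorial_of_lt (Nat.lt_succ_self _),
      Nat.cast_zero, zero_smul]⟩) hu

theorem isEmpty_linearEquiv {R M M' : Type*} [Ring R] [AddCommGroup M] [Module R M]
    [AddCommGroup M'] [Module R M'] {r : R} (h : ∀ u : M, ∃ n, r ^ n • u = 0) {v : M'}
    (hv : ∀ n, r ^ n • v ≠ 0) : IsEmpty (M ≃ₗ[R] M') := by
  refine ⟨fun e => ?_⟩
  obtain ⟨n, hn⟩ := h (e.symm v)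
  apply hv n
  rw [← e.apply_symm_apply v, ← map_smul, hn, map_zero]

end LocallyNilpotent

/-! ### The three families span `𝕀_1`. -/

section Generation

open WeylAlgebra

variable (K : Type*) [Field K]

/-- A filtration of `𝕀_1` compatible with the filtration of Bernstein. -/
def degreeFiltration (n : ℕ) : Submodule K (I1 K) :=
  degreeSpan K (ladderA K) n ⊔ degreeSpan K (ladderF K) n ⊔ degreeSpan K (ladderInt K) n

theorem degreeFiltration_mono : Monotone (degreeFiltration K) := fun _ _ h =>
  sup_le_sup (sup_le_sup (degreeSpan_mono K _ h) (degreeSpan_mono K _ h)) (degreeSpan_mono K _ h)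

theorem ladderA_mem_degreeFiltration {i j n : ℕ} (h : i + j ≤ n) :
    ladderA K (i, j) ∈ degreeFiltration K n :=
  Submodule.mem_sup_left (Submodule.mem_sup_left (mem_degreeSpan K _ h))

theorem ladderF_mem_degreeFiltration {i j n : ℕ} (h : i + j ≤ n) :
    ladderF K (i, j) ∈ degreeFiltration K n :=
  Submodule.mem_sup_left (Submodule.mem_sup_right (mem_degreeSpan K _ h))

theorem ladderInt_mem_degreeFiltration {i j n : ℕ} (h : i + j ≤ n) :
    ladderInt K (i, j) ∈ degreeFiltration K n :=
  Submodule.mem_sup_right (mem_degreeSpan K _ h)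

theorem degreeFiltration_fg (n : ℕ) : (degreeFiltration K n).FG :=
  ((degreeSpan_fg K _ n).sup (degreeSpan_fg K _ n)).sup (degreeSpan_fg K _ n)

theorem finrank_degreeFiltration_le (n : ℕ) :
    Module.finrank K (degreeFiltration K n) ≤ 3 * (n + 1) ^ 2 := by
  have h1 := Submodule.finrank_add_le_finrank_add_finrank
    (degreeSpan K (ladderA K) n ⊔ degreeSpan K (ladderF K) n) (degreeSpan K (ladderInt K) n)
  have h2 := Submodule.finrank_add_le_finrank_add_finrank
    (degreeSpan K (ladderA K) n) (degreeSpan K (ladderF K) n)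
  have hA := two_mul_finrank_degreeSpan_le K (ladderA K) n
  have hF := two_mul_finrank_degreeSpan_le K (ladderF K) n
  have hI := two_mul_finrank_degreeSpan_le K (ladderInt K) n
  rw [degreeFiltration]
  nlinarith

/-- The subspace of `𝕀_1` spanned by the elements `x^i ∂^j`, `e_{ij}` and `x^i ∫ x^j`. -/
def ladderSpan : Submodule K (I1 K) :=
  Submodule.span K (Set.range (ladderA K)) ⊔ Submodule.span K (Set.range (ladderF K)) ⊔
    Submodule.span K (Set.range (ladderInt K))

theorem degreeFiltration_le_ladderSpan (n : ℕ) : degreeFiltration K n ≤ ladderSpan K :=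
  sup_le_sup (sup_le_sup (Submodule.span_mono (Set.image_subset_range _ _))
    (Submodule.span_mono (Set.image_subset_range _ _)))
    (Submodule.span_mono (Set.image_subset_range _ _))

theorem exists_mem_degreeFiltration {u : I1 K} (hu : u ∈ ladderSpan K) :
    ∃ n, u ∈ degreeFiltration K n := by
  obtain ⟨v, hv, w, hw, rfl⟩ := Submodule.mem_sup.mp hu
  obtain ⟨a, ha, f, hf, rfl⟩ := Submodule.mem_sup.mp hv
  obtain ⟨k, hk⟩ := exists_mem_degreeSpan ha
  obtain ⟨l, hl⟩ := exists_mem_degreeSpan hf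
  obtain ⟨m, hm⟩ := exists_mem_degreeSpan hw
  refine ⟨max (max k l) m, Submodule.add_mem_sup (Submodule.add_mem_sup ?_ ?_) ?_⟩
  · exact degreeSpan_mono K _ (le_max_of_le_left (le_max_left k l)) hk
  · exact degreeSpan_mono K _ (le_max_of_le_left (le_max_right k l)) hl
  · exact degreeSpan_mono K _ (le_max_right _ m) hm

theorem I1.X_one_pow_smul (n : ℕ) (u : I1 K) : X K 2 1 ^ n • u = u * I1.d K ^ n := by
  induction n with
  | zero => simp
  | succ n ih => rw [pow_succ', mul_smul, ih, I1.X_one_smul, pow_succ, mul_assoc]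

theorem I1.D_one_pow_smul (n : ℕ) (u : I1 K) : D K 2 1 ^ n • u = u * I1.x K ^ n := by
  induction n with
  | zero => simp
  | succ n ih => rw [pow_succ', mul_smul, ih, I1.D_one_smul, pow_succ, mul_assoc]

theorem I1.D_zero_pow_smul (n : ℕ) (u : I1 K) : D K 2 0 ^ n • u = I1.d K ^ n * u := by
  induction n with
  | zero => simp
  | succ n ih => rw [pow_succ', mul_smul, ih, I1.D_zero_smul, pow_succ', mul_assoc]

theorem I1.adjoin_eq_top : Algebra.adjoin K {I1.x K, I1.d K, I1.int K} = ⊤ := by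
  have h : {I1.x K, I1.d K, I1.int K} =
      (I1.toEnd K : I1 K → Module.End K (Polynomial K)) ⁻¹' {opX K, opD K, opInt K} := by
    ext u
    simp only [Set.mem_preimage, Set.mem_insert_iff, Set.mem_singleton_iff, ← I1.toEnd_x,
      ← I1.toEnd_d, ← I1.toEnd_int, (I1.toEnd_injective K).eq_iff]
  rw [h]
  exact Algebra.adjoin_adjoin_coe_preimage

variable [CharZero K]

theorem generatorSpan_smul_degreeFiltration_le (n : ℕ) :
    generatorSpan K • degreeFiltration K n ≤ degreeFiltration K (n + 1) := by
  rw [degreeFiltration, Submodule.smul_sup, Submodule.smul_sup]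
  refine sup_le (sup_le_sup ((isLadder_ladderA K).generatorSpan_smul_degreeSpan_le n)
    ((isLadder_ladderF K).generatorSpan_smul_degreeSpan_le n) |>.trans le_sup_left) ?_
  refine span_smul_span_le ?_
  rintro v hv _ ⟨⟨i, j⟩, hs, rfl⟩
  have hs' : i + j ≤ n := mem_degreeFinset.mp (Finset.mem_coe.mp hs)
  have hI := fun i j (h : i + j ≤ n + 1) => ladderInt_mem_degreeFiltration K h
  have hA := fun i j (h : i + j ≤ n + 1) => ladderA_mem_degreeFiltration K h
  have hF := fun i j (h : i + j ≤ n + 1) => ladderF_mem_degreeFiltration K h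
  rcases hv with rfl | rfl | rfl | rfl | rfl
  · rw [one_smul]
    exact hI _ _ (by omega)
  · rw [I1.X_zero_smul, I1.x_mul_ladderInt]
    exact hI _ _ (by omega)
  · rw [I1.X_one_smul, I1.ladderInt_mul_d]
    refine Submodule.sub_mem _ (Submodule.sub_mem _ (hA _ _ (by omega)) ?_)
      (Submodule.smul_mem _ _ (hI _ _ (by omega)))
    split_ifs
    · exact hF _ _ (by omega)
    · exact Submodule.zero_mem _
  · rw [I1.D_zero_smul, I1.d_mul_ladderInt]
    exact Submodule.add_mem _ (Submodule.smul_mem _ _ (hI _ _ (by omega))) (hA _ _ (by omega))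
  · rw [I1.D_one_smul, I1.ladderInt_mul_x]
    exact hI _ _ (by omega)

theorem smul_mem_ladderSpan (a : WeylAlgebra K 2) {u : I1 K} (hu : u ∈ ladderSpan K) :
    a • u ∈ ladderSpan K := by
  have h : ∀ v ∈ generatorSpan K, ∀ u ∈ ladderSpan K, v • u ∈ ladderSpan K := by
    intro v hv u hu
    obtain ⟨n, hn⟩ := exists_mem_degreeFiltration K hu
    exact degreeFiltration_le_ladderSpan K _
      (generatorSpan_smul_degreeFiltration_le K n (Submodule.smul_mem_smul hv hn))
  exact smul_mem_of_generators _ (fun i => h _ (X_mem_generatorSpan K i))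
    (fun i => h _ (D_mem_generatorSpan K i)) a hu

/-- Integration by parts. -/
theorem I1.int_mul_x_pow_mul_int (i : ℕ) : I1.int K * I1.x K ^ i * I1.int K =
    ((i : K) + 1)⁻¹ • (I1.x K ^ (i + 1) * I1.int K - I1.int K * I1.x K ^ (i + 1)) := by
  have h : (i : K) + 1 ≠ 0 := by exact_mod_cast Nat.succ_ne_zero i
  -- Integration undoes differentiation here because multiples of `x` have no constant term.
  have h1 : I1.x K ^ (i + 1) = I1.int K * (I1.d K * I1.x K ^ (i + 1)) := by
    nth_rewrite 1 [pow_succ', ← I1.int_mul_d_mul_x K]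
    simp only [pow_succ', mul_assoc]
  have h2 : I1.x K ^ (i + 1) * I1.int K =
      I1.int K * I1.x K ^ (i + 1) + ((i : K) + 1) • (I1.int K * I1.x K ^ i * I1.int K) := by
    nth_rewrite 1 [h1]
    rw [I1.d_mul_x_pow, mul_add, add_mul, mul_assoc, mul_assoc (I1.x K ^ (i + 1)), I1.d_mul_int,
      mul_one, mul_smul_comm, smul_mul_assoc, Nat.add_sub_cancel]
    push_cast
    rfl
  rw [h2, add_sub_cancel_left, smul_smul, inv_mul_cancel₀ h, one_smul]

/-- On the three families: `∫ x^i ∂^j` is `x_2^j` applied to `∫ x^i`, `∫ e_{ij} = e_{i+1,j}`, and `∫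
x^i ∫ x^j` is handled by integration by parts. -/
theorem I1.int_mul_mem_ladderSpan {u : I1 K} (hu : u ∈ ladderSpan K) :
    I1.int K * u ∈ ladderSpan K := by
  have hI (i j : ℕ) : ladderInt K (i, j) ∈ ladderSpan K :=
    Submodule.mem_sup_right (Submodule.subset_span ⟨_, rfl⟩)
  suffices h : ladderSpan K ≤ (ladderSpan K).comap (LinearMap.mulLeft K (I1.int K)) from h hu
  refine sup_le (sup_le ?_ ?_) ?_ <;> rw [Submodule.span_le] <;> rintro _ ⟨⟨i, j⟩, rfl⟩ <;>
    change I1.int K * _ ∈ ladderSpan K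
  · have h : I1.int K * ladderA K (i, j) = X K 2 1 ^ j • ladderInt K (0, i) := by
      simp [I1.X_one_pow_smul, ladderA, ladderInt, mul_assoc]
    rw [h]
    exact smul_mem_ladderSpan K _ (hI _ _)
  · refine Submodule.mem_sup_left (Submodule.mem_sup_right ?_)
    rw [span_ladderF, ladderF, mul_smul_comm, I1.int_mul_e]
    exact (F K).smul_mem _ (F.e_mem K _ _)
  · have h : I1.int K * ladderInt K (i, j) =
        ((i : K) + 1)⁻¹ • (ladderInt K (i + 1, j) - ladderInt K (0, i + 1 + j)) := by
      simp only [ladderInt, ← mul_assoc, I1.int_mul_x_pow_mul_int, smul_mul_assoc, sub_mul,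
        pow_zero, one_mul, pow_add _ (i + 1) j]
    rw [h]
    exact Submodule.smul_mem _ _ (Submodule.sub_mem _ (hI _ _) (hI _ _))

theorem ladderSpan_eq_top : ladderSpan K = ⊤ := by
  refine eq_top_iff.mpr fun u _ => ?_
  have hone : (1 : I1 K) ∈ ladderSpan K :=
    Submodule.mem_sup_left (Submodule.mem_sup_left
      (Submodule.subset_span ⟨(0, 0), by simp [ladderA]⟩))
  rw [← mul_one u]
  refine mul_mem_of_mem_adjoin (s := {I1.x K, I1.d K, I1.int K}) ?_
    (I1.adjoin_eq_top K ▸ Algebra.mem_top) hone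
  rintro _ (rfl | rfl | rfl) v hv
  · rw [← I1.X_zero_smul]
    exact smul_mem_ladderSpan K _ hv
  · rw [← I1.D_zero_smul]
    exact smul_mem_ladderSpan K _ hv
  · exact I1.int_mul_mem_ladderSpan K hv

/-- The combined filtration grows at most quadratically, while the ladder of `F` inside `𝕀_1`
already forces quadratic growth. -/
theorem gkDim_I1 : gkDim K (WeylAlgebra K 2) (I1 K) = ((2 : ℕ) : EReal) :=
  le_antisymm (gkDim_le_two (degreeFiltration_mono K)
    (fun _ => exists_mem_degreeFiltration K (ladderSpan_eq_top K ▸ Submodule.mem_top))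
    (generatorSpan_smul_degreeFiltration_le K) (degreeFiltration_fg K) 3
    (finrank_degreeFiltration_le K)) (isLadder_ladderF K).two_le_gkDim

end Generation

/-! ### The quotient `𝕀_1 / (A_1 + F)` and the absence of a section. -/

section Quotient

open WeylAlgebra

variable (K : Type*) [Field K]

theorem mem_A1Sub_iff_mem_span {u : I1 K} :
    u ∈ A1Sub K ↔ u ∈ Submodule.span K (Set.range (ladderA K)) := by
  rw [span_ladderA, Submodule.restrictScalars_mem]

variable [CharZero K]

theorem I1.int_pow_mul_x (n : ℕ) :
    I1.int K ^ n * I1.x K - I1.x K * I1.int K ^ n = (-n : K) • I1.int K ^ (n + 1) := by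
  have h : I1.x K * I1.int K = I1.int K * I1.x K + I1.int K ^ 2 := by
    nth_rewrite 1 [← I1.int_mul_d_mul_x K]
    rw [I1.d_mul_x, mul_assoc, add_mul, mul_assoc, I1.d_mul_int, mul_one, one_mul, mul_add, pow_two]
  induction n with
  | zero => simp
  | succ n ih =>
    have h1 : I1.int K ^ (n + 1) * I1.x K - I1.x K * I1.int K ^ (n + 1) =
        I1.int K * (I1.int K ^ n * I1.x K - I1.x K * I1.int K ^ n) - I1.int K ^ (n + 2) := by
      rw [pow_succ', ← mul_assoc (I1.x K), h, pow_add _ n 2, ← Commute.pow_pow_self _ 2 n]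
      simp only [mul_sub, add_mul, mul_assoc]
      abel
    rw [h1, ih, mul_smul_comm, ← pow_succ']
    push_cast
    module

/-- The commutator with `x`, locally nilpotent on `A_1`, never kills `∫`; the constant built here is
`(-1)^n n!`. -/
theorem exists_pow_smul_int (n : ℕ) : ∃ c : K, c ≠ 0 ∧
    (D K 2 1 - X K 2 0) ^ n • I1.int K = c • I1.int K ^ (n + 1) := by
  induction n with
  | zero => exact ⟨1, one_ne_zero, by simp⟩
  | succ n ih =>
    obtain ⟨c, hc, h⟩ := ih
    refine ⟨c * -(n + 1 : ℕ), mul_ne_zero hc (neg_ne_zero.mpr (Nat.cast_ne_zero.mpr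
      n.succ_ne_zero)), ?_⟩
    rw [pow_succ', mul_smul, h, smul_algebra_smul_comm, sub_smul, I1.D_one_smul, I1.X_zero_smul,
      I1.int_pow_mul_x, smul_smul]

theorem I1.d_pow_mul_int_pow (n : ℕ) : I1.d K ^ n * I1.int K ^ n = 1 := by
  induction n with
  | zero => simp
  | succ n ih =>
    rw [pow_succ, pow_succ', mul_assoc, ← mul_assoc (I1.d K), I1.d_mul_int, one_mul, ih]

theorem I1.x_pow_ne_zero (n : ℕ) : I1.x K ^ n ≠ 0 := by
  simpa [ladderA] using (isLadder_ladderA K).apply_ne_zero (n, 0)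

theorem I1.d_pow_ne_zero (n : ℕ) : I1.d K ^ n ≠ 0 := by
  simpa [ladderA] using (isLadder_ladderA K).apply_ne_zero (0, n)

theorem mem_FSub_iff_mem_span {u : I1 K} :
    u ∈ FSub K ↔ u ∈ Submodule.span K (Set.range (ladderF K)) := by
  rw [span_ladderF, Submodule.restrictScalars_mem]

/-- Suppose `∫ = a + f`. A power of the commutator with `x` kills `a`, a power of right
multiplication by `x` kills `f`, and the two operators commute. Both applied to `∫` would give
`∫^{n+1} x^m = 0`, and multiplying on the left by `∂^{n+1}` would give `x^m = 0`. -/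
theorem I1.int_notMem : I1.int K ∉ A1Sub K ⊔ FSub K := by
  intro h
  obtain ⟨a, ha, f, hf, haf⟩ := Submodule.mem_sup.mp h
  obtain ⟨n, hn⟩ := (isLadder_ladderA K).exists_q₂_pow_smul_eq_zero
    ((mem_A1Sub_iff_mem_span K).mp ha)
  obtain ⟨m, hm⟩ := (isLadder_ladderF K).exists_q₂_pow_smul_eq_zero
    ((mem_FSub_iff_mem_span K).mp hf)
  obtain ⟨c, hc, hint⟩ := exists_pow_smul_int K n
  have hcomm : Commute (D K 2 1 ^ m) ((D K 2 1 - X K 2 0) ^ n) :=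
    ((Commute.refl _).sub_right (D_commute_X K 2 (by simp))).pow_pow m n
  have hzero : D K 2 1 ^ m • (D K 2 1 - X K 2 0) ^ n • I1.int K = 0 := by
    rw [← haf, smul_add, hn, zero_add, ← mul_smul, hcomm.eq, mul_smul, hm, smul_zero]
  rw [hint, smul_algebra_smul_comm, I1.D_one_pow_smul] at hzero
  have hzero' := congrArg (I1.d K ^ (n + 1) * ·) ((smul_eq_zero.mp hzero).resolve_left hc)
  simp only [← mul_assoc, I1.d_pow_mul_int_pow, one_mul, mul_zero] at hzero'
  exact I1.x_pow_ne_zero K m hzero'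

/-- The classes of `x^i ∫ x^j` in `𝕀_1 / (A_1 + F)`. -/
def ladderQ (s : ℕ × ℕ) : I1 K ⧸ (A1Sub K ⊔ FSub K) := (A1Sub K ⊔ FSub K).mkQ (ladderInt K s)

theorem mkQ_ladderA (s : ℕ × ℕ) : (A1Sub K ⊔ FSub K).mkQ (ladderA K s) = 0 :=
  (Submodule.Quotient.mk_eq_zero _).mpr (Submodule.mem_sup_left (ladderA_mem K s))

theorem mkQ_ladderF (s : ℕ × ℕ) : (A1Sub K ⊔ FSub K).mkQ (ladderF K s) = 0 :=
  (Submodule.Quotient.mk_eq_zero _).mpr (Submodule.mem_sup_right (ladderF_mem K s))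

theorem mkQ_smul (k : K) (u : I1 K) :
    (A1Sub K ⊔ FSub K).mkQ (k • u) = k • (A1Sub K ⊔ FSub K).mkQ u := rfl

/-- Modulo `A_1 + F` the boundary terms of `∂` disappear on both sides. Right multiplication by `x`
raises and right multiplication by `∂` lowers with a minus sign, so `x_2` and `∂_2` exchange roles.
-/
theorem isLadder_ladderQ :
    IsLadder (X K 2 0) (D K 2 1) (D K 2 0) (-X K 2 1) (ladderQ K) where
  p₁_mem := X_mem_generatorSpan K 0
  p₂_mem := D_mem_generatorSpan K 1
  q₁_mem := D_mem_generatorSpan K 0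
  q₂_mem := Submodule.neg_mem _ (X_mem_generatorSpan K 1)
  X_mem := by
    refine Fin.forall_fin_two.mpr ⟨Submodule.subset_span (by simp), ?_⟩
    rw [← Submodule.neg_mem_iff]
    exact Submodule.subset_span (by simp)
  D_mem i := by fin_cases i <;> exact Submodule.subset_span (by simp)
  p₁_smul i j := by simp only [ladderQ, ← map_smul, I1.X_zero_smul, I1.x_mul_ladderInt]
  p₂_smul i j := by simp only [ladderQ, ← map_smul, I1.D_one_smul, I1.ladderInt_mul_x]
  q₁_smul i j := by
    rw [ladderQ, ← map_smul, I1.D_zero_smul, I1.d_mul_ladderInt, map_add, mkQ_ladderA, add_zero,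
      mkQ_smul, ladderQ]
  q₂_smul i j := by
    rw [ladderQ, ← map_smul, neg_smul, I1.X_one_smul, I1.ladderInt_mul_d, map_neg, map_sub,
      map_sub, mkQ_ladderA, apply_ite (A1Sub K ⊔ FSub K).mkQ, mkQ_ladderF, map_zero, ite_self,
      sub_zero, zero_sub, neg_neg, mkQ_smul, ladderQ]
  ne_zero := by
    rw [ladderQ, Submodule.mkQ_apply, Ne, Submodule.Quotient.mk_eq_zero]
    simpa [ladderInt] using I1.int_notMem K

theorem span_ladderQ : Submodule.span K (Set.range (ladderQ K)) = ⊤ := by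
  let f : I1 K →ₗ[K] I1 K ⧸ (A1Sub K ⊔ FSub K) := (A1Sub K ⊔ FSub K).mkQ.restrictScalars K
  have h : ladderSpan K ≤ (Submodule.span K (Set.range (ladderQ K))).comap f := by
    refine sup_le (sup_le ?_ ?_) ?_ <;> rw [Submodule.span_le] <;> rintro _ ⟨s, rfl⟩
    · change f (ladderA K s) ∈ Submodule.span K (Set.range (ladderQ K))
      rw [show f (ladderA K s) = 0 from mkQ_ladderA K s]
      exact Submodule.zero_mem _
    · change f (ladderF K s) ∈ Submodule.span K (Set.range (ladderQ K))
      rw [show f (ladderF K s) = 0 from mkQ_ladderF K s]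
      exact Submodule.zero_mem _
    · exact Submodule.subset_span ⟨s, rfl⟩
  rw [ladderSpan_eq_top] at h
  refine eq_top_iff.mpr fun v _ => ?_
  obtain ⟨u, rfl⟩ := (A1Sub K ⊔ FSub K).mkQ_surjective v
  exact h (Submodule.mem_top (x := u))

/-- The sequence `0 → A_1 ⊕ F → 𝕀_1 → 𝕀_1 / (A_1 + F) → 0` has no section. -/
theorem not_exists_section :
    ¬ ∃ σ : (I1 K ⧸ (A1Sub K ⊔ FSub K)) →ₗ[WeylAlgebra K 2] I1 K,
      (A1Sub K ⊔ FSub K).mkQ ∘ₗ σ = LinearMap.id := by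
  rintro ⟨σ, hσ⟩
  -- The class of `∫` is killed by `x_2`, since `∫∂ = 1 - e_{00}` lies in `A_1 + F`. Its image `u`
  -- under a section satisfies `u∂ = 0`, hence `u = u∂∫ = 0`.
  have h1 : X K 2 1 • ladderQ K (0, 0) = 0 := by
    have := (isLadder_ladderQ K).q₂_smul 0 0
    rwa [Nat.cast_zero, zero_smul, neg_smul, neg_eq_zero] at this
  have h2 : σ (ladderQ K (0, 0)) * I1.d K = 0 := by
    rw [← I1.X_one_smul, ← map_smul, h1, map_zero]
  have h3 : σ (ladderQ K (0, 0)) = 0 := by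
    rw [← mul_one (σ _), ← I1.d_mul_int K, ← mul_assoc, h2, zero_mul]
  apply (isLadder_ladderQ K).ne_zero
  have := LinearMap.congr_fun hσ (ladderQ K (0, 0))
  rw [LinearMap.comp_apply, h3, map_zero] at this
  exact this.symm

end Quotient

/-! ### Monomial ladders in `K[x_1, x_2]` and `K[x_1, ∂_2]`. -/

section Polynomials

open WeylAlgebra

variable (K : Type*) [Field K]

/-- The monomials in two variables. -/
def polyMonomial (s : ℕ × ℕ) : MvPolynomial (Fin 2) K :=
  MvPolynomial.X 0 ^ s.1 * MvPolynomial.X 1 ^ s.2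

theorem polyMonomial_ne_zero (s : ℕ × ℕ) : polyMonomial K s ≠ 0 :=
  mul_ne_zero (pow_ne_zero _ (MvPolynomial.X_ne_zero _)) (pow_ne_zero _ (MvPolynomial.X_ne_zero _))

theorem span_polyMonomial : Submodule.span K (Set.range (polyMonomial K)) = ⊤ := by
  refine eq_top_iff.mpr fun p _ => ?_
  induction p using MvPolynomial.induction_on' with
  | monomial u a =>
    have h : MvPolynomial.monomial u a = a • polyMonomial K (u 0, u 1) := by
      rw [MvPolynomial.monomial_eq, Finsupp.prod_fintype _ _ (by simp), Fin.prod_univ_two,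
        polyMonomial, MvPolynomial.smul_eq_C_mul]
    rw [h]
    exact Submodule.smul_mem _ _ (Submodule.subset_span ⟨_, rfl⟩)
  | add p q hp hq => exact Submodule.add_mem _ (hp trivial) (hq trivial)

theorem mulVar_zero_polyMonomial (i j : ℕ) :
    mulVar K 0 (polyMonomial K (i, j)) = polyMonomial K (i + 1, j) := by
  simp only [mulVar, polyMonomial, LinearMap.mulLeft_apply]
  ring

theorem mulVar_one_polyMonomial (i j : ℕ) :
    mulVar K 1 (polyMonomial K (i, j)) = polyMonomial K (i, j + 1) := by
  simp only [mulVar, polyMonomial, LinearMap.mulLeft_apply]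
  ring

theorem partialD_zero_polyMonomial (i j : ℕ) :
    partialD K 0 (polyMonomial K (i, j)) = (i : K) • polyMonomial K (i - 1, j) := by
  simp [partialD, polyMonomial, MvPolynomial.smul_eq_C_mul, Derivation.leibniz,
    Derivation.leibniz_pow, MvPolynomial.pderiv_X]
  ring

theorem partialD_one_polyMonomial (i j : ℕ) :
    partialD K 1 (polyMonomial K (i, j)) = (j : K) • polyMonomial K (i, j - 1) := by
  simp [partialD, polyMonomial, MvPolynomial.smul_eq_C_mul, Derivation.leibniz,
    Derivation.leibniz_pow, MvPolynomial.pderiv_X]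
  ring

/-- The monomials in `K[x_1, x_2]`. -/
def ladderXX (s : ℕ × ℕ) : PolyXX K := polyMonomial K s

/-- The monomials in `K[x_1, ∂_2]`. -/
def ladderXD (s : ℕ × ℕ) : PolyXD K := polyMonomial K s

theorem PolyXX.X_smul (i : Fin 2) (p : PolyXX K) : X K 2 i • p = mulVar K i p := by
  exact LinearMap.congr_fun (lift_X (B := Module.End K (MvPolynomial (Fin 2) K)) (mulVar K)
    (partialD K) (mulVar_comm K) (partialD_comm K) (partialD_mulVar K) i) p

theorem PolyXX.D_smul (i : Fin 2) (p : PolyXX K) : D K 2 i • p = partialD K i p := by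
  exact LinearMap.congr_fun (lift_D (B := Module.End K (MvPolynomial (Fin 2) K)) (mulVar K)
    (partialD K) (mulVar_comm K) (partialD_comm K) (partialD_mulVar K) i) p

theorem PolyXD.X_smul (i : Fin 2) (p : PolyXD K) :
    X K 2 i • p = (![mulVar K 0, -partialD K 1] i : Module.End K (MvPolynomial (Fin 2) K)) p := by
  change actionXD K (X K 2 i) p = _
  unfold actionXD
  exact LinearMap.congr_fun (lift_X (B := Module.End K (MvPolynomial (Fin 2) K))
    ![mulVar K 0, -partialD K 1] ![partialD K 0, mulVar K 1] _ _ _ i) p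

theorem PolyXD.D_smul (i : Fin 2) (p : PolyXD K) :
    D K 2 i • p = (![partialD K 0, mulVar K 1] i : Module.End K (MvPolynomial (Fin 2) K)) p := by
  change actionXD K (D K 2 i) p = _
  unfold actionXD
  exact LinearMap.congr_fun (lift_D (B := Module.End K (MvPolynomial (Fin 2) K))
    ![mulVar K 0, -partialD K 1] ![partialD K 0, mulVar K 1] _ _ _ i) p

theorem isLadder_ladderXX :
    IsLadder (X K 2 0) (X K 2 1) (D K 2 0) (D K 2 1) (ladderXX K) where
  p₁_mem := X_mem_generatorSpan K 0
  p₂_mem := X_mem_generatorSpan K 1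
  q₁_mem := D_mem_generatorSpan K 0
  q₂_mem := D_mem_generatorSpan K 1
  X_mem i := by fin_cases i <;> exact Submodule.subset_span (by simp)
  D_mem i := by fin_cases i <;> exact Submodule.subset_span (by simp)
  p₁_smul i j := (PolyXX.X_smul K 0 _).trans (mulVar_zero_polyMonomial K i j)
  p₂_smul i j := (PolyXX.X_smul K 1 _).trans (mulVar_one_polyMonomial K i j)
  q₁_smul i j := (PolyXX.D_smul K 0 _).trans (partialD_zero_polyMonomial K i j)
  q₂_smul i j := (PolyXX.D_smul K 1 _).trans (partialD_one_polyMonomial K i j)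
  ne_zero := polyMonomial_ne_zero K (0, 0)

theorem isLadder_ladderXD :
    IsLadder (X K 2 0) (D K 2 1) (D K 2 0) (-X K 2 1) (ladderXD K) where
  p₁_mem := X_mem_generatorSpan K 0
  p₂_mem := D_mem_generatorSpan K 1
  q₁_mem := D_mem_generatorSpan K 0
  q₂_mem := Submodule.neg_mem _ (X_mem_generatorSpan K 1)
  X_mem := by
    refine Fin.forall_fin_two.mpr ⟨Submodule.subset_span (by simp), ?_⟩
    rw [← Submodule.neg_mem_iff]
    exact Submodule.subset_span (by simp)
  D_mem i := by fin_cases i <;> exact Submodule.subset_span (by simp)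
  p₁_smul i j := (PolyXD.X_smul K 0 _).trans (mulVar_zero_polyMonomial K i j)
  p₂_smul i j := (PolyXD.D_smul K 1 _).trans (mulVar_one_polyMonomial K i j)
  q₁_smul i j := (PolyXD.D_smul K 0 _).trans (partialD_zero_polyMonomial K i j)
  q₂_smul i j := by
    rw [neg_smul]
    refine (congrArg Neg.neg (PolyXD.X_smul K 1 _)).trans ?_
    exact (neg_neg _).trans (partialD_one_polyMonomial K i j)
  ne_zero := polyMonomial_ne_zero K (0, 0)

theorem span_ladderXX : Submodule.span K (Set.range (ladderXX K)) = ⊤ := span_polyMonomial K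

theorem span_ladderXD : Submodule.span K (Set.range (ladderXD K)) = ⊤ := span_polyMonomial K

end Polynomials

/-! ### Modules with two disjoint simple submodules and a simple quotient. -/

section CompositionSeries

variable {R M : Type*} [Ring R] [AddCommGroup M] [Module R M] {A F : Submodule R M}

/-- The composition series `0 < F < A + F < M` for disjoint simple submodules `A` and `F` with
simple quotient `M / (A + F)`. -/
def compositionSeriesOfAtoms (hA : IsAtom A) (hF : IsAtom F) (hAF : Disjoint A F)
    (hQ : IsCoatom (A ⊔ F)) : CompositionSeries (Submodule R M) where
  length := 3
  toFun := ![⊥, F, A ⊔ F, ⊤]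
  step i := by
    fin_cases i
    · exact bot_covBy_iff.mpr hF
    · exact covBy_sup_of_inf_covBy_left (hAF.eq_bot ▸ bot_covBy_iff.mpr hA)
    · exact covBy_top_iff.mpr hQ

theorem length_eq_three (hA : IsAtom A) (hF : IsAtom F) (hAF : Disjoint A F)
    (hQ : IsCoatom (A ⊔ F)) : Module.length R M = 3 :=
  (Module.length_compositionSeries (compositionSeriesOfAtoms hA hF hAF hQ) rfl rfl).symm

theorem exists_compositionFactor_equiv (hA : IsAtom A) (hF : IsAtom F) (hAF : Disjoint A F)
    (hQ : IsCoatom (A ⊔ F)) (s : CompositionSeries (Submodule R M)) (hs : s.head = ⊥)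
    (hs' : s.last = ⊤) : ∃ e : Fin 3 ≃ Fin s.length,
      Nonempty (compositionFactor s (e 0) ≃ₗ[R] F) ∧
      Nonempty (compositionFactor s (e 1) ≃ₗ[R] A) ∧
      Nonempty (compositionFactor s (e 2) ≃ₗ[R] (M ⧸ (A ⊔ F))) := by
  obtain ⟨f, hf⟩ := s.jordan_holder (compositionSeriesOfAtoms hA hF hAF hQ) hs hs'
  have key (k : Fin (compositionSeriesOfAtoms hA hF hAF hQ).length) : Nonempty (compositionFactor s (f.symm k) ≃ₗ[R]
      compositionFactor (compositionSeriesOfAtoms hA hF hAF hQ) k) := by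
    have h := hf (f.symm k)
    rw [f.apply_symm_apply] at h
    exact ⟨h.linearEquiv⟩
  refine ⟨f.symm, ?_, ?_, ?_⟩
  · obtain ⟨g⟩ := key (0 : Fin 3)
    have h : (F ⧸ Submodule.comap F.subtype ⊥) ≃ₗ[R] F :=
      Submodule.quotEquivOfEqBot _ (by simp)
    exact ⟨g.trans h⟩
  · obtain ⟨g⟩ := key (1 : Fin 3)
    -- The second isomorphism theorem identifies `(A + F) / F` with `A / (A ∩ F)`, which is `A` by
    -- disjointness.
    have hbot : Submodule.comap A.subtype A ⊓ Submodule.comap A.subtype F = ⊥ := by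
      rw [← Submodule.comap_inf, hAF.eq_bot]
      simp
    exact ⟨g.trans ((LinearMap.quotientInfEquivSupQuotient A F).symm.trans
      (Submodule.quotEquivOfEqBot _ hbot))⟩
  · obtain ⟨g⟩ := key (2 : Fin 3)
    have h : (↥(⊤ : Submodule R M) ⧸ Submodule.comap (⊤ : Submodule R M).subtype (A ⊔ F)) ≃ₗ[R]
        (M ⧸ (A ⊔ F)) := Submodule.Quotient.equiv _ _ Submodule.topEquiv (by ext u; simp)
    exact ⟨g.trans h⟩

/-- If a quotient map with simple target has no section, its kernel contains all simple
submodules. -/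
theorem le_of_isAtom_of_not_exists_section {S N : Submodule R M} (hS : IsCoatom S) (hN : IsAtom N)
    (h : ¬ ∃ σ : (M ⧸ S) →ₗ[R] M, S.mkQ ∘ₗ σ = LinearMap.id) : N ≤ S := by
  by_contra hle
  -- A simple `N` outside the maximal submodule `S` is a complement of `S`, so the quotient map
  -- restricts to an isomorphism on `N` whose inverse is a section.
  have hdisj : Disjoint N S := hN.not_le_iff_disjoint.mp hle
  have hsup : N ⊔ S = ⊤ := hS.2 _ (lt_of_le_of_ne le_sup_right fun heq => hle (heq ▸ le_sup_left))
  have hcompl : IsCompl S N := ⟨hdisj.symm, codisjoint_iff.mpr (sup_comm S N ▸ hsup)⟩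
  refine h ⟨N.subtype ∘ₗ (Submodule.quotientEquivOfIsCompl S N hcompl).toLinearMap, ?_⟩
  refine LinearMap.ext fun q => ?_
  exact Submodule.mk_quotientEquivOfIsCompl_apply hcompl q

theorem socle_eq_sup (hA : IsAtom A) (hF : IsAtom F) (hQ : IsCoatom (A ⊔ F))
    (h : ¬ ∃ σ : (M ⧸ (A ⊔ F)) →ₗ[R] M, (A ⊔ F).mkQ ∘ₗ σ = LinearMap.id) :
    socle R M = A ⊔ F := by
  refine le_antisymm (sSup_le fun N hN => ?_) (sup_le (le_sSup ?_) (le_sSup ?_))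
  · exact le_of_isAtom_of_not_exists_section hQ (isSimpleModule_iff_isAtom.mp hN) h
  · exact isSimpleModule_iff_isAtom.mpr hA
  · exact isSimpleModule_iff_isAtom.mpr hF

theorem exact_coprod_subtype_mkQ :
    Function.Exact (A.subtype.coprod F.subtype) (A ⊔ F).mkQ := by
  rw [LinearMap.exact_iff, Submodule.ker_mkQ, LinearMap.range_coprod, Submodule.range_subtype,
    Submodule.range_subtype]

theorem injective_coprod_subtype (h : Disjoint A F) :
    Function.Injective (A.subtype.coprod F.subtype) := by
  rw [← LinearMap.ker_eq_bot, LinearMap.ker_coprod_of_disjoint_range _ _ (by simpa using h)]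
  simp

end CompositionSeries

/-! ### The factors of `𝕀_1` and their distinctness. -/

section Factors

open WeylAlgebra

variable (K : Type*) [Field K]

theorem isLadder_A1Sub : IsLadder (X K 2 0) (X K 2 1) (D K 2 0 - X K 2 1) (D K 2 1 - X K 2 0)
    fun s => (⟨ladderA K s, ladderA_mem K s⟩ : A1Sub K) :=
  (isLadder_ladderA K).restrict (A1Sub K) (ladderA_mem K)

theorem span_ladder_A1Sub :
    Submodule.span K (Set.range fun s => (⟨ladderA K s, ladderA_mem K s⟩ : A1Sub K)) = ⊤ :=
  span_range_restrict (ladderA_mem K) (span_ladderA K)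

variable [CharZero K]

theorem isLadder_FSub : IsLadder (X K 2 0) (X K 2 1) (D K 2 0) (D K 2 1)
    fun s => (⟨ladderF K s, ladderF_mem K s⟩ : FSub K) :=
  (isLadder_ladderF K).restrict (FSub K) (ladderF_mem K)

theorem span_ladder_FSub :
    Submodule.span K (Set.range fun s => (⟨ladderF K s, ladderF_mem K s⟩ : FSub K)) = ⊤ :=
  span_range_restrict (ladderF_mem K) (span_ladderF K)

theorem D_zero_pow_smul_one_ne_zero (n : ℕ) : D K 2 0 ^ n • (⟨1, (A1 K).one_mem⟩ : A1Sub K) ≠ 0 := by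
  intro h
  have := congrArg Subtype.val h
  rw [Submodule.coe_smul, I1.D_zero_pow_smul, mul_one] at this
  exact I1.d_pow_ne_zero K n this

/-- `∂_1` is locally nilpotent on `F`, but in `A_1` the element `∂_1^n · 1 = ∂^n` is never zero. -/
theorem isEmpty_FSub_equiv_A1Sub : IsEmpty (FSub K ≃ₗ[WeylAlgebra K 2] A1Sub K) :=
  isEmpty_linearEquiv (M' := A1Sub K) (fun _ => (isLadder_FSub K).exists_q₁_pow_smul_eq_zero
    (span_ladder_FSub K ▸ Submodule.mem_top)) (D_zero_pow_smul_one_ne_zero K)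

/-- `∂_2` lowers on `F` and raises on the quotient. -/
theorem isEmpty_FSub_equiv_quotient :
    IsEmpty (FSub K ≃ₗ[WeylAlgebra K 2] (I1 K ⧸ (A1Sub K ⊔ FSub K))) := by
  refine isEmpty_linearEquiv (r := D K 2 1) (v := ladderQ K (0, 0))
    (fun _ => (isLadder_FSub K).exists_q₂_pow_smul_eq_zero
      (span_ladder_FSub K ▸ Submodule.mem_top)) fun n => ?_
  have h := (isLadder_ladderQ K).eq_pow_smul 0 n
  rw [pow_zero, one_mul] at h
  exact h ▸ (isLadder_ladderQ K).apply_ne_zero _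

theorem isEmpty_A1Sub_equiv_quotient :
    IsEmpty (A1Sub K ≃ₗ[WeylAlgebra K 2] (I1 K ⧸ (A1Sub K ⊔ FSub K))) := by
  have h := isEmpty_linearEquiv (M' := A1Sub K) (fun u => (isLadder_ladderQ K).exists_q₁_pow_smul_eq_zero
    (span_ladderQ K ▸ Submodule.mem_top : u ∈ _)) (D_zero_pow_smul_one_ne_zero K)
  exact ⟨fun e => h.false e.symm⟩

theorem isAtom_A1Sub : IsAtom (A1Sub K) :=
  isSimpleModule_iff_isAtom.mp ((isLadder_A1Sub K).isSimpleModule (span_ladder_A1Sub K))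

theorem isAtom_FSub : IsAtom (FSub K) :=
  isSimpleModule_iff_isAtom.mp ((isLadder_FSub K).isSimpleModule (span_ladder_FSub K))

theorem isCoatom_A1Sub_sup_FSub : IsCoatom (A1Sub K ⊔ FSub K) :=
  isSimpleModule_iff_isCoatom.mp ((isLadder_ladderQ K).isSimpleModule (span_ladderQ K))

/-- Distinct simple submodules meet in zero, and these two are distinct because they are not
isomorphic. -/
theorem disjoint_A1Sub_FSub : Disjoint (A1Sub K) (FSub K) := by
  refine (isAtom_A1Sub K).disjoint_of_ne (isAtom_FSub K) fun h => ?_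
  exact (isEmpty_FSub_equiv_A1Sub K).false (LinearEquiv.ofEq _ _ h.symm)

/-- Only finite generation is assembled from the factors; the dimension comes from the filtration of
`𝕀_1` itself. -/
theorem isHolonomic_I1 : IsHolonomic K 2 (I1 K) := by
  have hA := ((isLadder_A1Sub K).isHolonomic (span_ladder_A1Sub K)).1
  have hF := ((isLadder_FSub K).isHolonomic (span_ladder_FSub K)).1
  have hQ := ((isLadder_ladderQ K).isHolonomic (span_ladderQ K)).1
  exact ⟨Module.Finite.of_submodule_quotient (A1Sub K ⊔ FSub K), gkDim_I1 K⟩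

end Factors

end IntDiff

end

theorem mainTheorem2 (K : Type*) [Field K] [CharZero K] :
    -- `𝕀_1` is a holonomic `A_2`-module of length 3
    (IsHolonomic K 2 (I1 K) ∧
      Module.length (WeylAlgebra K 2) (I1 K) = 3 ∧
      -- its composition factors are `F`, `A_1` and `𝕀_1 / (A_1 + F)`, each occurring once
      (∀ s : CompositionSeries (Submodule (WeylAlgebra K 2) (I1 K)),
        s.head = ⊥ → s.last = ⊤ →
          ∃ e : Fin 3 ≃ Fin s.length,
            Nonempty (compositionFactor s (e 0) ≃ₗ[WeylAlgebra K 2] FSub K) ∧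
            Nonempty (compositionFactor s (e 1) ≃ₗ[WeylAlgebra K 2] A1Sub K) ∧
            Nonempty (compositionFactor s (e 2) ≃ₗ[WeylAlgebra K 2]
              (I1 K ⧸ (A1Sub K ⊔ FSub K)))) ∧
      -- `F ≅ K[x_1, x_2]` and `𝕀_1 / (A_1 + F) ≅ K[x_1, ∂_2]`
      Nonempty (FSub K ≃ₗ[WeylAlgebra K 2] PolyXX K) ∧
      Nonempty ((I1 K ⧸ (A1Sub K ⊔ FSub K)) ≃ₗ[WeylAlgebra K 2] PolyXD K) ∧
      -- the factors are pairwise non-isomorphic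
      IsEmpty (FSub K ≃ₗ[WeylAlgebra K 2] A1Sub K) ∧
      IsEmpty (FSub K ≃ₗ[WeylAlgebra K 2] (I1 K ⧸ (A1Sub K ⊔ FSub K))) ∧
      IsEmpty (A1Sub K ≃ₗ[WeylAlgebra K 2] (I1 K ⧸ (A1Sub K ⊔ FSub K))) ∧
      -- each factor is simple, holonomic, of multiplicity 1, with endomorphism algebra `K`
      (IsSimpleModule (WeylAlgebra K 2) (FSub K) ∧
        IsHolonomic K 2 (FSub K) ∧ HasMultiplicity K 2 (FSub K) 1 ∧
        Nonempty (Module.End (WeylAlgebra K 2) (FSub K) ≃ₐ[K] K)) ∧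
      (IsSimpleModule (WeylAlgebra K 2) (A1Sub K) ∧
        IsHolonomic K 2 (A1Sub K) ∧ HasMultiplicity K 2 (A1Sub K) 1 ∧
        Nonempty (Module.End (WeylAlgebra K 2) (A1Sub K) ≃ₐ[K] K)) ∧
      (IsSimpleModule (WeylAlgebra K 2) (I1 K ⧸ (A1Sub K ⊔ FSub K)) ∧
        IsHolonomic K 2 (I1 K ⧸ (A1Sub K ⊔ FSub K)) ∧
        HasMultiplicity K 2 (I1 K ⧸ (A1Sub K ⊔ FSub K)) 1 ∧
        Nonempty (Module.End (WeylAlgebra K 2) (I1 K ⧸ (A1Sub K ⊔ FSub K)) ≃ₐ[K] K))) ∧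
    -- the socle of `𝕀_1` is the direct sum of `A_1` and `F`
    (Disjoint (A1Sub K) (FSub K) ∧
      socle (WeylAlgebra K 2) (I1 K) = A1Sub K ⊔ FSub K) ∧
    -- `0 → A_1 ⊕ F → 𝕀_1 → 𝕀_1 / (A_1 + F) → 0` is exact and does not split
    (Function.Injective ((A1Sub K).subtype.coprod (FSub K).subtype) ∧
      Function.Exact ((A1Sub K).subtype.coprod (FSub K).subtype) (A1Sub K ⊔ FSub K).mkQ ∧
      Function.Surjective (A1Sub K ⊔ FSub K).mkQ ∧
      ¬ ∃ σ : (I1 K ⧸ (A1Sub K ⊔ FSub K)) →ₗ[WeylAlgebra K 2] I1 K,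
        (A1Sub K ⊔ FSub K).mkQ ∘ₗ σ = LinearMap.id) := by
  have hA := isLadder_A1Sub K
  have hA' := span_ladder_A1Sub K
  have hF := isLadder_FSub K
  have hF' := span_ladder_FSub K
  have hQ := isLadder_ladderQ K
  have hQ' := span_ladderQ K
  have hAF := disjoint_A1Sub_FSub K
  have haA := isAtom_A1Sub K
  have haF := isAtom_FSub K
  have hcQ := isCoatom_A1Sub_sup_FSub K
  have hsec := not_exists_section K
  exact ⟨⟨isHolonomic_I1 K, length_eq_three haA haF hAF hcQ,
    exists_compositionFactor_equiv haA haF hAF hcQ,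
    hF.nonempty_linearEquiv hF' (isLadder_ladderXX K) (span_ladderXX K),
    hQ.nonempty_linearEquiv hQ' (isLadder_ladderXD K) (span_ladderXD K),
    isEmpty_FSub_equiv_A1Sub K, isEmpty_FSub_equiv_quotient K, isEmpty_A1Sub_equiv_quotient K,
    ⟨hF.isSimpleModule hF', hF.isHolonomic hF', hF.hasMultiplicity hF',
      hF.nonempty_end_algEquiv hF'⟩,
    ⟨hA.isSimpleModule hA', hA.isHolonomic hA', hA.hasMultiplicity hA',
      hA.nonempty_end_algEquiv hA'⟩,
    ⟨hQ.isSimpleModule hQ', hQ.isHolonomic hQ', hQ.hasMultiplicity hQ',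
      hQ.nonempty_end_algEquiv hQ'⟩⟩,
    ⟨hAF, socle_eq_sup haA haF hcQ hsec⟩,
    injective_coprod_subtype hAF, exact_coprod_subtype_mkQ, Submodule.mkQ_surjective _, hsec⟩
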